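/- Let $T>0$, $g\colon\mathbb{R}^n\times\mathbb{R}^n\to\mathbb{R}\cup\{\infty\}$, $f\colon[0,T]\times\mathbb{R}^n\times\mathbb{R}^m\to\mathbb{R}^n$, let $\varphi\colon\mathbb{R}^n\to\mathbb{R}\cup\{\infty\}$ be lower semicontinuous with effective domain $C:=\operatorname{dom}\varphi$, let $C_0,C_T\subset\mathbb{R}^n$, let $\psi_1,\dots,\psi_r\colon\mathbb{R}^n\to\mathbb{R}$, and let $U\colon[0,T]\rightrightarrows\mathbb{R}^m$ be a multifunction. Let $\mathscr U$ be the set of Lebesgue measurable $u\colon[0,T]\to\mathbb{R}^m$ with $u(t)\in U(t)$ for a.e. $t\in[0,T]$. A pair $(x,u)$ is admissible if $x\colon[0,T]\to\mathbb{R}^n$ is absolutely continuous, $u\in\mathscr U$, and $$\dot x(t)\in f(t,x(t),u(t))-\partial\varphi(x(t))\ \text{ for a.e. } t\in[0,T],\qquad x(0)\in C_0,\qquad x(T)\in C_T,$$ where $\partial\varphi$ is the Clarke subdifferential (empty outside $\operatorname{dom}\varphi$). Problem $(P)$ is to minimize $g(x(0),x(T))$ over all admissible pairs; an optimal solution of $(P)$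 is an admissible pair $(x,u)$ with $g(x(0),x(T))<\infty$ and $g(x(0),x(T))\le g(y(0),y(T))$ for every admissible pair $(y,w)$. Assume the following. (1) For all $x\in C$ and $u\in\bigcup_{t\in[0,T]}U(t)$ the function $f(\cdot,x,u)$ is Lebesgue measurable on $[0,T]$. There is $M>0$ such that for a.e. $t\in[0,T]$: $(x,u)\mapsto f(t,x,u)$ is continuous on $C\times U(t)$; $x\mapsto f(t,x,u)$ is $M$-Lipschitz on $C$ for each $u\in U(t)$; and $\|f(t,x,u)\|\le M$ for all $(x,u)\in C\times U(t)$. Moreover, for every $x\in C$ and $u\in\mathscr U$ the function $t\mapsto f(t,x,u(t))$ is Lebesgue measurable on $[0,T]$. (2) $C$ is nonempty and compact, $C=\bigcap_{i=1}^r\{x:\psi_i(x)\le 0\}$, and $\operatorname{int}C$ is connected. There is $\rho>0$ such that every $\psi_i$ is $\mathcal C^{1,1}$ (that is, $\mathcal{C}^1$ with locally Lipschitz gradient) on $C+\rho B$, where $B$ is the open unit ball. There is $\eta>0$ such that, for every $c\in C$ for which $\mathcal I_c:=\{i:\psi_i(c)=0\}$ is nonempty and all $\lambda_i\ge0$ $(i\in\mathcal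 I_c)$ with $\sum_{i\in\mathcal I_c}\lambda_i=1$, one has $\big\|\sum_{i\in\mathcal I_c}\lambda_i\nabla\psi_i(c)\big\|>2\eta$. (3) $\varphi$ is Lipschitz on $C$ and $\mathcal C^1$ on $\operatorname{int}C$, and $\nabla\varphi$ is Lipschitz on $\operatorname{int}C$. (4) $C_0\subset C$ is nonempty and closed; $C_T$ is nonempty and closed; the graph of $U$ is $\mathscr L\times\mathscr B$-measurable (Lebesgue in $t$, Borel in $u$); and the sets $U(t)$, $t\in[0,T]$, are closed and bounded uniformly in $t$. (5) $g$ is lower semicontinuous, and for a.e. $t\in[0,T]$ the set $f(t,x,U(t))$ is convex for all $x\in C$. Then $(P)$ has an optimal solution if and only if there is an admissible pair $(z_o,u_o)$ with $(z_o(0),z_o(T))\in\operatorname{dom}g$, i.e. $g(z_o(0),z_o(T))<\infty$. -/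

import Mathlib

open Set Filter Topology MeasureTheory
open scoped NNReal InnerProductSpace

namespace Sweeping

/-- The σ-algebra of Lebesgue measurable subsets of the real line. -/
noncomputable abbrev lebesgueSigma : MeasurableSpace ℝ :=
  (inferInstance : MeasurableSpace (NullMeasurableSpace ℝ (volume : Measure ℝ)))

/-- The Clarke tangent cone to `A` at `a`: those `v` such that for all sequences `a k → a` in `A`
and `s k → 0` with `s k > 0` there are `v k → v` with `a k + s k • v k ∈ A`. -/
def clarkeTangentCone {F : Type*} [NormedAddCommGroup F] [NormedSpace ℝ F]
    (A : Set F) (a : F) : Set F :=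
  {v | ∀ (y : ℕ → F) (s : ℕ → ℝ), (∀ k, y k ∈ A) → Tendsto y atTop (𝓝 a) →
    (∀ k, 0 < s k) → Tendsto s atTop (𝓝 0) →
    ∃ w : ℕ → F, Tendsto w atTop (𝓝 v) ∧ ∀ k, y k + s k • w k ∈ A}

/-- The effective domain of an extended-real-valued function. -/
def effDomain {X : Type*} (h : X → EReal) : Set X := {x | h x < ⊤}

/-- The epigraph of an extended-real-valued function. -/
def epigraph {X : Type*} (h : X → EReal) : Set (X × ℝ) := {p | h p.1 ≤ (p.2 : EReal)}

/-- The Clarke subdifferential: `ζ ∈ ∂h(x)` when `x ∈ dom h` and `(ζ, -1)` belongs to the Clarke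
normal cone (the polar of the Clarke tangent cone) to `epi h` at `(x, h x)`.
It is empty for `x` outside `dom h`. -/
def clarkeSubdifferential {E : Type*} [NormedAddCommGroup E] [InnerProductSpace ℝ E]
    (h : E → EReal) (x : E) : Set E :=
  {ζ | x ∈ effDomain h ∧
    ∀ p ∈ clarkeTangentCone (epigraph h) (x, (h x).toReal), ⟪ζ, p.1⟫_ℝ + (-1) * p.2 ≤ 0}

/-- `h` is of class `C^{1,1}` on the open set `O`: continuously differentiable there, with a
locally Lipschitz gradient. -/
def IsC11On {E : Type*} [NormedAddCommGroup E] [InnerProductSpace ℝ E] [CompleteSpace E]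
    (h : E → ℝ) (O : Set E) : Prop :=
  ContDiffOn ℝ 1 h O ∧ LocallyLipschitzOn O (gradient h)

/-- The set of control functions: Lebesgue measurable on `[0,T]`, with `u(t) ∈ U(t)` for almost
every `t ∈ [0,T]`. (Only the restriction of `u` to `[0,T]` matters.) -/
def controls {G : Type*} [MeasurableSpace G] (T : ℝ) (U : ℝ → Set G) : Set (ℝ → G) :=
  {u | AEMeasurable u (volume.restrict (Icc 0 T)) ∧
    ∀ᵐ t ∂(volume.restrict (Icc 0 T)), u t ∈ U t}

/-- Admissible pairs: `x` is absolutely continuous on `[0,T]`, `u` is a control function,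
`x'(t) ∈ f(t, x(t), u(t)) - ∂φ(x(t))` for almost every `t ∈ [0,T]`, `x(0) ∈ C₀`, `x(T) ∈ C_T`.
(Only the restrictions of `x` and `u` to `[0,T]` matter.) -/
structure IsAdmissible {E G : Type*} [NormedAddCommGroup E] [InnerProductSpace ℝ E]
    [MeasurableSpace G] (T : ℝ) (f : ℝ → E → G → E) (φ : E → EReal) (C₀ CT : Set E)
    (U : ℝ → Set G) (x : ℝ → E) (u : ℝ → G) : Prop where
  absCont : AbsolutelyContinuousOnInterval x 0 T
  control : u ∈ controls T U
  dynamics : ∀ᵐ t ∂(volume.restrict (Icc 0 T)),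
    ∃ ζ ∈ clarkeSubdifferential φ (x t), HasDerivAt x (f t (x t) (u t) - ζ) t
  initial : x 0 ∈ C₀
  terminal : x T ∈ CT

/-- Optimal solutions: admissible pairs of finite cost whose cost is least among all admissible
pairs. -/
structure IsOptimal {E G : Type*} [NormedAddCommGroup E] [InnerProductSpace ℝ E]
    [MeasurableSpace G] (T : ℝ) (g : E × E → EReal) (f : ℝ → E → G → E) (φ : E → EReal)
    (C₀ CT : Set E) (U : ℝ → Set G) (x : ℝ → E) (u : ℝ → G) : Prop where
  admissible : IsAdmissible T f φ C₀ CT U x u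
  finite_cost : (x 0, x T) ∈ effDomain g
  minimal : ∀ y w, IsAdmissible T f φ C₀ CT U y w → g (x 0, x T) ≤ g (y 0, y T)

end Sweeping

/-!
The set of end points `(x 0, x T)` of admissible pairs is compact, so the lower semicontinuous cost
`g` attains its minimum on it as soon as it is nonempty, and the minimum is finite as soon as some
admissible pair has finite cost. Everything rests on the closure theorem
`exists_isAdmissible_of_tendsto`.

*Uniform bounds.* Let `x' = p - ζ` with `p = f(t, x, u)` and `ζ ∈ ∂φ(x)`. Since `x` stays in `C`, at
almost every time `x'` annihilates the gradients of all active constraints. By the constraint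
qualification some `v` points strictly inside all active constraints, so `-x' + ε v` is a
hypertangent to `C` and lifts to the epigraph of `φ`. Testing `ζ` against it and letting `ε → 0`
yields `‖x'‖ ≤ ‖p‖ + K`, where `K` is the Lipschitz constant of `φ`
(`norm_deriv_le_of_mem_clarkeSubdifferential`). Hence the trajectories `x` and the integrals
`P t = ∫₀ᵗ p` are equi-Lipschitz, and the Arzelà–Ascoli theorem gives a convergent subsequence of
the pairs `(x, P)`.

*Limits of velocities.* No weak compactness is needed. For the limits `x` and `P`, the subgradient
is recovered as `ζ = P' - x'`: adding a hypertangent turns a Clarke tangent of the epigraph into a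
tangent at all nearby points, so that the inequality it imposes on subgradients can be averaged over
short time intervals and differentiated (`mem_clarkeSubdifferential_of_tendsto`). In the time
dependent part, the increments of `⟪P, e⟫` are bounded by the integrals of the support function of
the convex velocity set `f(t, x t, U t)` in direction `e`; Lebesgue's differentiation theorem and the
Hahn–Banach theorem give `P' t ∈ f(t, x t, U t)` (`ae_deriv_mem_image`).

*Measurable selection.* The control of the limit comes from Filippov's lemma
(`exists_measurable_selection_eq`). As `f` is measurable only along controls, both this lemma and the
measurability of the support functions use a Castaing representation of `U` (`exists_castaing`).
It comes from the measurable selection theorem for Borel graphs, which in turn rests on the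
universal measurability of analytic sets (`nullMeasurableSet_of_analyticSet`).
-/

namespace Sweeping

/-! ### Projections of Borel sets and measurable selections -/

section Projection

variable {α : Type*} [TopologicalSpace α] [PolishSpace α] [MeasurableSpace α] [BorelSpace α]

/-- An analytic set can be approximated in measure from inside by compact sets: bounding the
coordinates of the Baire space one after the other keeps the measure of the image above `r`. -/
lemma exists_isCompact_subset_range_le_measure {μ : Measure α} [IsFiniteMeasure μ]
    {f : (ℕ → ℕ) → α} (hf : Continuous f) {r : ENNReal} (hr : r < μ (range f)) :
    ∃ K ⊆ range f, IsCompact K ∧ r ≤ μ K := by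
  have step : ∀ (k : ℕ) (S : Set (ℕ → ℕ)), r < μ (f '' S) →
      ∃ n : ℕ, r < μ (f '' (S ∩ {x | x k ≤ n})) := by
    intro k S hS
    have h1 : f '' S = ⋃ n : ℕ, f '' (S ∩ {x | x k ≤ n}) := by
      rw [← image_iUnion, ← inter_iUnion]
      congr 1
      refine (inter_eq_left.2 fun x _ => ?_).symm
      exact mem_iUnion.2 ⟨x k, le_refl (x k)⟩
    rw [h1, Directed.measure_iUnion] at hS
    · exact lt_iSup_iff.1 hS
    · refine Monotone.directed_le fun a b hab => ?_
      exact image_mono (inter_subset_inter_right _ fun x hx => le_trans hx hab)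
  choose N hN using step
  let S : ℕ → {S : Set (ℕ → ℕ) // r < μ (f '' S)} := fun k =>
    Nat.rec ⟨univ, by rwa [image_univ]⟩
      (fun k S => ⟨S.1 ∩ {x | x k ≤ N k S.1 S.2}, hN k S.1 S.2⟩) k
  let n : ℕ → ℕ := fun k => N k (S k).1 (S k).2
  have hS_succ : ∀ k, (S (k + 1)).1 = (S k).1 ∩ {x | x k ≤ n k} := fun k => rfl
  have hS_le : ∀ k, ∀ x ∈ (S k).1, ∀ i < k, x i ≤ n i := by
    intro k
    induction k with
    | zero => intro x _ i hi; omega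
    | succ k ih =>
      intro x hx i hi
      rw [hS_succ] at hx
      rcases Nat.lt_succ_iff_lt_or_eq.1 hi with h | rfl
      · exact ih x hx.1 i h
      · exact hx.2
  have hK₀ : IsCompact (univ.pi fun i => Iic (n i)) :=
    isCompact_univ_pi fun i => (finite_Iic (n i)).isCompact
  refine ⟨f '' (univ.pi fun i => Iic (n i)), image_subset_range _ _, hK₀.image hf, ?_⟩
  rw [Set.measure_eq_iInf_isOpen]
  refine le_iInf₂ fun V hV => le_iInf fun hVo => ?_
  -- Some truncation is already mapped into `V`, by compactness of the full truncation.
  have : ∃ k, (S k).1 ⊆ f ⁻¹' V := by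
    by_contra! hcon
    have : ∀ k, ∃ x ∈ (S k).1, f x ∉ V := fun k => not_subset.1 (hcon k)
    choose x hxS hxV using this
    obtain ⟨y, hy, σ, hσ, hlim⟩ := hK₀.tendsto_subseq (x := fun k i => min (x k i) (n i))
      (fun k i _ => min_le_right (x k i) (n i))
    have hx : Tendsto (fun j => x (σ j)) atTop (𝓝 y) := by
      rw [tendsto_pi_nhds] at hlim ⊢
      intro i
      refine (hlim i).congr' ?_
      filter_upwards [eventually_gt_atTop i] with j hj
      exact min_eq_left (hS_le _ _ (hxS (σ j)) i (hj.trans_le (hσ.id_le j)))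
    have h2 := (hf.tendsto y).comp hx
    obtain ⟨j, hj⟩ := (h2.eventually (hVo.mem_nhds (hV (mem_image_of_mem f hy)))).exists
    exact hxV _ hj
  obtain ⟨k, hk⟩ := this
  exact (S k).2.le.trans (measure_mono (image_subset_iff.2 hk))

/-- Analytic sets are universally measurable. -/
lemma nullMeasurableSet_of_analyticSet (μ : Measure α) [IsFiniteMeasure μ] {s : Set α}
    (hs : AnalyticSet s) : NullMeasurableSet s μ := by
  rw [AnalyticSet] at hs
  rcases hs with rfl | ⟨f, hf, rfl⟩
  · exact nullMeasurableSet_empty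
  by_cases h0 : μ (range f) = 0
  · exact NullMeasurableSet.of_null h0
  obtain ⟨r, -, hr, hrlim⟩ := exists_seq_strictMono_tendsto' (pos_iff_ne_zero.2 h0)
  choose K hKs hK hrK using fun k => exists_isCompact_subset_range_le_measure hf (hr k).2
  have hm : MeasurableSet (⋃ k, K k) := MeasurableSet.iUnion fun k => (hK k).measurableSet
  refine hm.nullMeasurableSet.congr (ae_eq_of_subset_of_measure_ge (iUnion_subset hKs) ?_
    hm.nullMeasurableSet (measure_ne_top _ _))
  exact le_of_tendsto' hrlim fun k => (hrK k).trans (measure_mono (subset_iUnion K k))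

variable {F : Type*} [TopologicalSpace F] [PolishSpace F] [MeasurableSpace F] [BorelSpace F]

/-- The projection of a Borel set is measurable up to a null set. -/
lemma nullMeasurableSet_exists_mem (μ : Measure α) [IsFiniteMeasure μ] {G : Set (α × F)}
    (hG : MeasurableSet G) : NullMeasurableSet {t | ∃ y, (t, y) ∈ G} μ := by
  have : {t | ∃ y, (t, y) ∈ G} = Prod.fst '' G := by ext; simp
  rw [this]
  exact nullMeasurableSet_of_analyticSet μ (hG.analyticSet.image_of_continuous continuous_fst)

end Projection

section Selection

variable {α : Type*} [TopologicalSpace α] [PolishSpace α] [MeasurableSpace α] [BorelSpace α]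
  {F : Type*} [MetricSpace F] [CompleteSpace F] [SecondCountableTopology F]
  [MeasurableSpace F] [BorelSpace F]

/-- A multifunction with Borel graph can be shrunk to a multifunction whose values have radius at
most `ε`, with measurably chosen centres. -/
lemma exists_measurable_shrink [Nonempty F] (μ : Measure α) [IsFiniteMeasure μ] {G : Set (α × F)}
    (hG : MeasurableSet G) (hne : ∀ᵐ t ∂μ, ∃ y, (t, y) ∈ G) {ε : ℝ} (hε : 0 < ε) :
    ∃ (G' : Set (α × F)) (c : α → F), G' ⊆ G ∧ MeasurableSet G' ∧ Measurable c ∧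
      (∀ᵐ t ∂μ, ∃ y, (t, y) ∈ G') ∧ ∀ p ∈ G', dist p.2 (c p.1) < ε := by
  classical
  have hnull : ∀ i : ℕ, NullMeasurableSet
      {t | ∃ y, (t, y) ∈ G ∩ {p | dist p.2 (TopologicalSpace.denseSeq F i) < ε}} μ := fun i =>
    nullMeasurableSet_exists_mem μ (hG.inter (measurableSet_lt (by fun_prop) measurable_const))
  choose A hAm hA using fun i => (hnull i).exists_measurable_superset_ae_eq.imp
    fun B hB => (⟨hB.2.1, hB.2.2⟩ : _ ∧ _)
  -- The second alternative only makes the search for an index succeed on the exceptional null set.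
  have hex : ∀ t, ∃ i, t ∈ A i ∨ ∀ k, t ∉ A k := by
    intro t
    by_cases h : ∃ i, t ∈ A i
    · exact h.imp fun i hi => Or.inl hi
    · exact ⟨0, Or.inr (not_exists.1 h)⟩
  let c : α → F := fun t => TopologicalSpace.denseSeq F (Nat.find (hex t))
  have hc : Measurable c := by
    refine (measurable_from_nat (f := TopologicalSpace.denseSeq F)).comp (measurable_find hex ?_)
    intro i
    have : {t | t ∈ A i ∨ ∀ k, t ∉ A k} = A i ∪ ⋂ k, (A k)ᶜ := by ext; simp
    rw [this]
    exact (hAm i).union (MeasurableSet.iInter fun k => (hAm k).compl)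
  refine ⟨G ∩ {p | dist p.2 (c p.1) < ε}, c, inter_subset_left,
    hG.inter (measurableSet_lt (by fun_prop) measurable_const), hc, ?_, fun p hp => hp.2⟩
  filter_upwards [hne, ae_all_iff.2 fun i => (hA i).mem_iff] with t ⟨y, hy⟩ hAt
  obtain ⟨i, hi⟩ := (TopologicalSpace.denseRange_denseSeq F).exists_dist_lt y hε
  have hi' : t ∈ A i := (hAt i).2 ⟨y, hy, hi⟩
  rcases Nat.find_spec (hex t) with h | h
  · exact (hAt _).1 h
  · exact absurd hi' (h i)

/-- **Measurable selection**: a multifunction with Borel graph and nonempty closed values has a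
Borel selection, up to a null set. Shrinking the values repeatedly gives centres that converge to a
point of the closed value; the measurable projections make each choice of centre measurable. -/
lemma exists_measurable_selection_of_ae_nonempty [Nonempty F] (μ : Measure α) [IsFiniteMeasure μ]
    {G : Set (α × F)} (hG : MeasurableSet G) (hne : ∀ᵐ t ∂μ, ∃ y, (t, y) ∈ G)
    (hcl : ∀ᵐ t ∂μ, IsClosed {y | (t, y) ∈ G}) :
    ∃ u : α → F, Measurable u ∧ ∀ᵐ t ∂μ, (t, u t) ∈ G := by
  let P : Set (α × F) → Prop := fun H => MeasurableSet H ∧ ∀ᵐ t ∂μ, ∃ y, (t, y) ∈ H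
  have step : ∀ (k : ℕ) (H : {H // P H}), ∃ (H' : {H // P H}) (c : α → F), H'.1 ⊆ H.1 ∧
      Measurable c ∧ ∀ p ∈ H'.1, dist p.2 (c p.1) < (1 / 2 : ℝ) ^ k := by
    intro k H
    obtain ⟨H', c, h1, h2, h3, h4, h5⟩ := exists_measurable_shrink μ H.2.1 H.2.2
      (ε := (1 / 2 : ℝ) ^ k) (by positivity)
    exact ⟨⟨H', h2, h4⟩, c, h1, h3, h5⟩
  choose next c hsub hcm hcd using step
  let H : ℕ → {H // P H} := fun k => Nat.rec ⟨G, hG, hne⟩ (fun k H => next k H) k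
  have hH : ∀ k, (H (k + 1)).1 ⊆ (H k).1 := fun k => hsub k (H k)
  have hanti : Antitone fun k => (H k).1 := antitone_nat_of_succ_le hH
  let w : ℕ → α → F := fun k => c k (H k)
  have hw : ∀ k, Measurable (w k) := fun k => hcm k (H k)
  have hdist : ∀ k, ∀ p ∈ (H (k + 1)).1, dist p.2 (w k p.1) < (1 / 2 : ℝ) ^ k :=
    fun k => hcd k (H k)
  have hall : ∀ᵐ t ∂μ, ∀ k, ∃ y, (t, y) ∈ (H k).1 := ae_all_iff.2 fun k => (H k).2.2
  have hlim : ∀ᵐ t ∂μ, ∃ l, Tendsto (fun k => w k t) atTop (𝓝 l) := by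
    filter_upwards [hall] with t ht
    refine cauchySeq_tendsto_of_complete (cauchySeq_of_le_geometric (1 / 2) 2 (by norm_num) ?_)
    intro k
    obtain ⟨y, hy⟩ := ht (k + 2)
    have h1 := hdist k _ (hH _ hy)
    have h2 := hdist (k + 1) _ hy
    have h3 := dist_triangle_left (w k t) (w (k + 1) t) y
    have h4 : (1 / 2 : ℝ) ^ (k + 1) ≤ (1 / 2 : ℝ) ^ k :=
      pow_le_pow_of_le_one (by norm_num) (by norm_num) (by omega)
    dsimp only at h1 h2
    linarith
  obtain ⟨u, hum, hu⟩ := measurable_limit_of_tendsto_metrizable_ae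
    (fun k => (hw k).aemeasurable) hlim
  refine ⟨u, hum, ?_⟩
  filter_upwards [hu, hall, hcl] with t hut ht hct
  choose y hy using fun k => ht (k + 1)
  have hyu : Tendsto y atTop (𝓝 (u t)) := by
    refine hut.congr_dist ?_
    have h0 : Tendsto (fun k : ℕ => (1 / 2 : ℝ) ^ k) atTop (𝓝 0) :=
      tendsto_pow_atTop_nhds_zero_of_lt_one (by norm_num) (by norm_num)
    refine squeeze_zero (fun _ => dist_nonneg) (fun k => ?_) h0
    rw [dist_comm]
    exact (hdist k _ (hy k)).le
  exact hct.mem_of_tendsto hyu (Eventually.of_forall fun k => hanti (Nat.zero_le (k + 1)) (hy k))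

/-- Measurable selection for a multifunction whose values may be empty. -/
lemma exists_measurable_selection [Nonempty F] (μ : Measure α) [IsFiniteMeasure μ]
    {G : Set (α × F)} (hG : MeasurableSet G) (hcl : ∀ᵐ t ∂μ, IsClosed {y | (t, y) ∈ G}) :
    ∃ u : α → F, Measurable u ∧ ∀ᵐ t ∂μ, (∃ y, (t, y) ∈ G) → (t, u t) ∈ G := by
  obtain ⟨D, -, hDm, hD⟩ := (nullMeasurableSet_exists_mem μ hG).exists_measurable_superset_ae_eq
  have hD' := hD.mem_iff
  obtain ⟨u, hum, hu⟩ := exists_measurable_selection_of_ae_nonempty μ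
    (G := G ∪ Prod.fst ⁻¹' Dᶜ) (hG.union (measurable_fst hDm.compl)) (by
      filter_upwards [hD'] with t ht
      by_cases h : t ∈ D
      · exact (ht.1 h).imp fun y hy => Or.inl hy
      · exact ⟨Classical.arbitrary F, Or.inr h⟩) (by
      filter_upwards [hcl] with t ht
      exact ht.union (isClosed_const (p := t ∈ Dᶜ)))
  refine ⟨u, hum, ?_⟩
  filter_upwards [hu, hD'] with t ht htD hne
  exact ht.resolve_right fun h => h (htD.2 hne)

/-- A Castaing representation: countably many measurable selections that are dense in the values of
a multifunction with Borel graph and nonempty closed values. -/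
lemma exists_castaing [Nonempty F] (μ : Measure α) [IsFiniteMeasure μ] {G : Set (α × F)}
    (hG : MeasurableSet G) (hne : ∀ᵐ t ∂μ, ∃ y, (t, y) ∈ G)
    (hcl : ∀ᵐ t ∂μ, IsClosed {y | (t, y) ∈ G}) :
    ∃ u : ℕ → α → F, (∀ j, Measurable (u j)) ∧
      ∀ᵐ t ∂μ, (∀ j, (t, u j t) ∈ G) ∧
        ∀ y, (t, y) ∈ G → ∀ ε > 0, ∃ j, dist (u j t) y < ε := by
  classical
  obtain ⟨u₀, hu₀m, hu₀⟩ := exists_measurable_selection_of_ae_nonempty μ hG hne hcl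
  have hsel : ∀ q : ℕ × ℕ, ∃ u : α → F, Measurable u ∧ ∀ᵐ t ∂μ,
      (∃ y, (t, y) ∈ G ∩ {p | dist p.2 (TopologicalSpace.denseSeq F q.1) ≤ 1 / ((q.2 : ℝ) + 1)}) →
      (t, u t) ∈ G ∩ {p | dist p.2 (TopologicalSpace.denseSeq F q.1) ≤ 1 / ((q.2 : ℝ) + 1)} := by
    intro q
    refine exists_measurable_selection μ
      (hG.inter (measurableSet_le (by fun_prop) measurable_const)) ?_
    filter_upwards [hcl] with t ht
    exact ht.inter (isClosed_le (by fun_prop) continuous_const)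
  choose v hvm hv using hsel
  let e : ℕ ≃ ℕ × ℕ := Nat.pairEquiv.symm
  refine ⟨fun j t => if (t, v (e j) t) ∈ G then v (e j) t else u₀ t, fun j => ?_, ?_⟩
  · exact Measurable.ite ((measurable_id.prodMk (hvm (e j))) hG) (hvm _) hu₀m
  filter_upwards [hu₀, ae_all_iff.2 hv] with t h0 hvt
  refine ⟨fun j => ?_, fun y hy ε hε => ?_⟩
  · by_cases h : (t, v (e j) t) ∈ G
    · simp [h]
    · simpa [h] using h0
  obtain ⟨k, hk⟩ := exists_nat_one_div_lt (half_pos hε)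
  obtain ⟨i, hi⟩ := (TopologicalSpace.denseRange_denseSeq F).exists_dist_lt y
    (ε := 1 / ((k : ℝ) + 1)) (by positivity)
  have h1 := hvt (i, k) ⟨y, hy, hi.le⟩
  refine ⟨e.symm (i, k), ?_⟩
  have h2 : (t, v (i, k) t) ∈ G := h1.1
  have h3 : dist (v (i, k) t) (TopologicalSpace.denseSeq F i) ≤ 1 / ((k : ℝ) + 1) := h1.2
  simp only [Equiv.apply_symm_apply, h2, if_true]
  have h4 := dist_triangle_right (v (i, k) t) y (TopologicalSpace.denseSeq F i)
  linarith

end Selection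

/-- A set that is measurable for the product of the Lebesgue and the Borel σ-algebra agrees with a
Borel set, apart from a null set of first coordinates. -/
lemma exists_measurableSet_ae_iff {F : Type*} [MeasurableSpace F] {S : Set (ℝ × F)}
    (hS : MeasurableSet[lebesgueSigma.prod inferInstance] S) :
    ∃ G : Set (ℝ × F), MeasurableSet G ∧ ∀ᵐ t : ℝ, ∀ y, (t, y) ∈ G ↔ (t, y) ∈ S := by
  let m : MeasurableSpace (ℝ × F) :=
    { MeasurableSet' := fun S => ∃ G : Set (ℝ × F), MeasurableSet G ∧
        ∀ᵐ t : ℝ, ∀ y, (t, y) ∈ G ↔ (t, y) ∈ S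
      measurableSet_empty := ⟨∅, MeasurableSet.empty, by simp⟩
      measurableSet_compl := by
        rintro S ⟨G, hG, h⟩
        refine ⟨Gᶜ, hG.compl, ?_⟩
        filter_upwards [h] with t ht y
        exact not_congr (ht y)
      measurableSet_iUnion := by
        intro S hS
        choose G hG h using hS
        refine ⟨⋃ i, G i, MeasurableSet.iUnion hG, ?_⟩
        filter_upwards [ae_all_iff.2 h] with t ht y
        simp only [mem_iUnion, ht] }
  have hle : lebesgueSigma.prod inferInstance ≤ m := by
    refine sup_le ?_ ?_
    · rintro _ ⟨A, hA, rfl⟩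
      have hA' : NullMeasurableSet A (volume : Measure ℝ) := hA
      obtain ⟨B, -, hB, hBA⟩ := hA'.exists_measurable_superset_ae_eq
      refine ⟨Prod.fst ⁻¹' B, measurable_fst hB, ?_⟩
      filter_upwards [hBA.mem_iff] with t ht y
      exact ht
    · rintro _ ⟨A, hA, rfl⟩
      exact ⟨Prod.snd ⁻¹' A, measurable_snd hA, Eventually.of_forall fun t y => Iff.rfl⟩
  exact hle S hS

/-! ### Hypertangents -/

section Hypertangent

variable {F : Type*} [NormedAddCommGroup F] [NormedSpace ℝ F]

/-- The cone of hypertangents to `A` at `a`: those `v` such that `y + s • w ∈ A` for all `y ∈ A`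
near `a`, all `w` near `v` and all small `s > 0`. -/
def hypertangentCone (A : Set F) (a : F) : Set F :=
  {v | ∀ᶠ q : F × F × ℝ in 𝓝 a ×ˢ 𝓝 v ×ˢ 𝓝[>] 0, q.1 ∈ A → q.1 + q.2.2 • q.2.1 ∈ A}

lemma eventually_mem_hypertangentCone {A : Set F} {a v : F} (hv : v ∈ hypertangentCone A a) :
    ∀ᶠ b in 𝓝 a, v ∈ hypertangentCone A b := by
  obtain ⟨p, hp, q, hq, h⟩ := eventually_prod_iff.1 hv
  filter_upwards [eventually_eventually_nhds.2 hp] with b hb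
  exact eventually_prod_iff.2 ⟨p, hb, q, hq, h⟩

lemma hypertangentCone_subset_clarkeTangentCone {A : Set F} {a : F} :
    hypertangentCone A a ⊆ clarkeTangentCone A a := by
  classical
  intro v hv y s hyA hy hs hs0
  have hlim : Tendsto (fun k => (y k, v, s k)) atTop (𝓝 a ×ˢ 𝓝 v ×ˢ 𝓝[>] 0) :=
    hy.prodMk (tendsto_const_nhds.prodMk
      (tendsto_nhdsWithin_iff.2 ⟨hs0, Eventually.of_forall hs⟩))
  refine ⟨fun k => if y k + s k • v ∈ A then v else 0, ?_, fun k => ?_⟩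
  · refine tendsto_const_nhds.congr' ?_
    filter_upwards [hlim.eventually hv] with k hk
    rw [if_pos (hk (hyA k))]
  · by_cases h : y k + s k • v ∈ A
    · simpa only [if_pos h] using h
    · simpa only [if_neg h, smul_zero, add_zero] using hyA k

/-- Clarke tangents perturbed by a hypertangent are hypertangents: a step along the Clarke tangent
stays in `A` after a small correction, which the openness of the hypertangent condition absorbs. -/
lemma add_mem_hypertangentCone {A : Set F} {a v h : F} (hv : v ∈ clarkeTangentCone A a)
    (hh : h ∈ hypertangentCone A a) : v + h ∈ hypertangentCone A a := by
  -- A sequence violating the claim is corrected by the Clarke tangent `v`; the remaining step is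
  -- close to `h`.
  by_contra hcon
  have hpos : ∀ᶠ q : F × F × ℝ in 𝓝 a ×ˢ 𝓝 (v + h) ×ˢ 𝓝[>] 0, 0 < q.2.2 :=
    (tendsto_snd.comp tendsto_snd).eventually self_mem_nhdsWithin
  have hcon' : ¬∀ᶠ q : F × F × ℝ in 𝓝 a ×ˢ 𝓝 (v + h) ×ˢ 𝓝[>] 0,
      q.1 ∈ A → q.1 + q.2.2 • q.2.1 ∈ A := hcon
  have hfr := (not_eventually.1 hcon').and_eventually hpos
  obtain ⟨q, hq, hqp⟩ := exists_seq_forall_of_frequently hfr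
  have h1 : Tendsto (fun k => (q k).1) atTop (𝓝 a) := tendsto_fst.comp hq
  have h2 : Tendsto (fun k => (q k).2.1) atTop (𝓝 (v + h)) :=
    tendsto_fst.comp (tendsto_snd.comp hq)
  have h3 : Tendsto (fun k => (q k).2.2) atTop (𝓝[>] 0) :=
    tendsto_snd.comp (tendsto_snd.comp hq)
  obtain ⟨w, hw, hwA⟩ := hv (fun k => (q k).1) (fun k => (q k).2.2)
    (fun k => (Classical.not_imp.1 (hqp k).1).1) h1 (fun k => (hqp k).2)
    (h3.mono_right nhdsWithin_le_nhds)
  have h4 : Tendsto (fun k => (q k).1 + (q k).2.2 • w k) atTop (𝓝 a) := by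
    simpa using h1.add ((h3.mono_right nhdsWithin_le_nhds).smul hw)
  have h5 : Tendsto (fun k => (q k).2.1 - w k) atTop (𝓝 h) := by
    simpa using h2.sub hw
  obtain ⟨k, hk⟩ := ((h4.prodMk (h5.prodMk h3)).eventually hh).exists
  refine (Classical.not_imp.1 (hqp k).1).2 ?_
  have := hk (hwA k)
  rwa [add_assoc, ← smul_add, add_sub_cancel] at this

lemma smul_mem_hypertangentCone {A : Set F} {a h : F} (hh : h ∈ hypertangentCone A a) {c : ℝ}
    (hc : 0 < c) : c • h ∈ hypertangentCone A a := by
  have hlim : Tendsto (fun q : F × F × ℝ => (q.1, c⁻¹ • q.2.1, c * q.2.2))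
      (𝓝 a ×ˢ 𝓝 (c • h) ×ˢ 𝓝[>] 0) (𝓝 a ×ˢ 𝓝 h ×ˢ 𝓝[>] 0) := by
    refine tendsto_fst.prodMk (Tendsto.prodMk ?_ ?_)
    · have h1 : Tendsto (fun w : F => c⁻¹ • w) (𝓝 (c • h)) (𝓝 h) := by
        have := (continuous_const_smul (T := F) c⁻¹).tendsto (c • h)
        rwa [inv_smul_smul₀ hc.ne'] at this
      exact h1.comp (tendsto_fst.comp tendsto_snd)
    · have h1 : Tendsto (fun s : ℝ => c * s) (𝓝[>] 0) (𝓝[>] 0) := by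
        refine tendsto_nhdsWithin_iff.2 ⟨?_, ?_⟩
        · have : Tendsto (fun s : ℝ => c * s) (𝓝 0) (𝓝 0) := by
            simpa using (continuous_const_mul c).tendsto (0 : ℝ)
          exact this.mono_left nhdsWithin_le_nhds
        · filter_upwards [self_mem_nhdsWithin] with s hs
          exact mul_pos hc hs
      exact h1.comp (tendsto_snd.comp tendsto_snd)
  filter_upwards [hlim.eventually hh] with q hq hqA
  have := hq hqA
  rwa [smul_smul, mul_right_comm, mul_inv_cancel₀ hc.ne', one_mul] at this

/-- Lower semicontinuity of the Clarke tangent cone at points where a hypertangent exists. -/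
lemma eventually_add_smul_mem_clarkeTangentCone {A : Set F} {a v h : F}
    (hv : v ∈ clarkeTangentCone A a) (hh : h ∈ hypertangentCone A a) {ε : ℝ} (hε : 0 < ε) :
    ∀ᶠ b in 𝓝 a, v + ε • h ∈ clarkeTangentCone A b :=
  (eventually_mem_hypertangentCone
    (add_mem_hypertangentCone hv (smul_mem_hypertangentCone hh hε))).mono
    fun _ hb => hypertangentCone_subset_clarkeTangentCone hb

end Hypertangent

section Clarke

lemma coe_toReal_of_mem_effDomain {X : Type*} {φ : X → EReal} (hbot : ∀ x, φ x ≠ ⊥) {x : X}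
    (hx : x ∈ effDomain φ) : ((φ x).toReal : EReal) = φ x :=
  EReal.coe_toReal (ne_of_lt hx) (hbot x)

variable {E : Type*} [NormedAddCommGroup E] [InnerProductSpace ℝ E]

/-- Hypertangents to the domain of a function that is Lipschitz on its domain lift to hypertangents
to the epigraph. -/
lemma mem_hypertangentCone_epigraph {φ : E → EReal} (hbot : ∀ x, φ x ≠ ⊥) {K : ℝ≥0}
    (hK : LipschitzOnWith K (fun x => (φ x).toReal) (effDomain φ)) {x v : E}
    (hv : v ∈ hypertangentCone (effDomain φ) x) {s : ℝ} (hs : K * ‖v‖ < s) (a : ℝ) :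
    (v, s) ∈ hypertangentCone (epigraph φ) (x, a) := by
  have hproj : Tendsto (fun q : (E × ℝ) × (E × ℝ) × ℝ => (q.1.1, q.2.1.1, q.2.2))
      (𝓝 (x, a) ×ˢ 𝓝 (v, s) ×ˢ 𝓝[>] 0) (𝓝 x ×ˢ 𝓝 v ×ˢ 𝓝[>] 0) := by
    refine Tendsto.prodMk ?_ (Tendsto.prodMk ?_ ?_)
    · exact (continuous_fst.tendsto (x, a)).comp tendsto_fst
    · exact (continuous_fst.tendsto (v, s)).comp (tendsto_fst.comp tendsto_snd)
    · exact tendsto_snd.comp tendsto_snd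
  have hsl : ∀ᶠ w : E × ℝ in 𝓝 (v, s), K * ‖w.1‖ < w.2 :=
    ContinuousAt.eventually_lt (by fun_prop) (by fun_prop) hs
  have hsl' := (tendsto_fst.comp (tendsto_snd (f := 𝓝 (x, a))
    (g := 𝓝 (v, s) ×ˢ 𝓝[>] (0 : ℝ)))).eventually hsl
  have hpos : ∀ᶠ q : (E × ℝ) × (E × ℝ) × ℝ in 𝓝 (x, a) ×ˢ 𝓝 (v, s) ×ˢ 𝓝[>] 0, 0 < q.2.2 :=
    (tendsto_snd.comp tendsto_snd).eventually self_mem_nhdsWithin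
  filter_upwards [hproj.eventually hv, hsl', hpos] with q hq hqs hq0 hqe
  have hqe' : φ q.1.1 ≤ (q.1.2 : EReal) := hqe
  have hd : q.1.1 ∈ effDomain φ := lt_of_le_of_lt hqe' (EReal.coe_lt_top _)
  have hd' := hq hd
  change φ (q.1.1 + q.2.2 • q.2.1.1) ≤ ((q.1.2 + q.2.2 * q.2.1.2 : ℝ) : EReal)
  rw [← coe_toReal_of_mem_effDomain hbot hd, EReal.coe_le_coe_iff] at hqe'
  rw [← coe_toReal_of_mem_effDomain hbot hd', EReal.coe_le_coe_iff]
  have h1 := (le_abs_self _).trans ((Real.dist_eq _ _).symm.le.trans (hK.dist_le_mul _ hd' _ hd))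
  rw [dist_eq_norm, add_sub_cancel_left, norm_smul, Real.norm_of_nonneg hq0.le] at h1
  have h2 : q.2.2 * (K * ‖q.2.1.1‖) ≤ q.2.2 * q.2.1.2 :=
    mul_le_mul_of_nonneg_left (le_of_lt hqs) hq0.le
  linarith

/-- Upper semicontinuity of the Clarke subdifferential of a function that is Lipschitz on its
domain, at points where the domain has a hypertangent, tested against a tangent direction of the
epigraph. -/
lemma eventually_inner_le_of_mem_clarkeSubdifferential {φ : E → EReal} (hbot : ∀ x, φ x ≠ ⊥)
    {K : ℝ≥0} (hK : LipschitzOnWith K (fun x => (φ x).toReal) (effDomain φ)) {x v : E}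
    (hx : x ∈ effDomain φ) (hv : v ∈ hypertangentCone (effDomain φ) x) {p : E × ℝ}
    (hp : p ∈ clarkeTangentCone (epigraph φ) (x, (φ x).toReal)) {ε : ℝ} (hε : 0 < ε) :
    ∀ᶠ y in 𝓝 x, ∀ ζ ∈ clarkeSubdifferential φ y,
      ⟪ζ, p.1 + ε • v⟫_ℝ ≤ p.2 + ε * (K * ‖v‖ + 1) := by
  have h1 := eventually_add_smul_mem_clarkeTangentCone hp
    (mem_hypertangentCone_epigraph hbot hK hv (lt_add_one _) _) hε
  have h2 : Tendsto (fun y => (y, (φ y).toReal)) (𝓝[effDomain φ] x) (𝓝 (x, (φ x).toReal)) :=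
    (tendsto_id.mono_left nhdsWithin_le_nhds).prodMk_nhds (hK.continuousOn x hx)
  filter_upwards [eventually_nhdsWithin_iff.1 (h2.eventually h1)] with y hy ζ hζ
  have := hζ.2 _ (hy hζ.1)
  simp only [Prod.fst_add, Prod.smul_fst, Prod.snd_add, Prod.smul_snd, smul_eq_mul] at this
  linarith

end Clarke

/-! ### Sets defined by finitely many inequalities -/

section Inequalities

variable {E : Type*} [NormedAddCommGroup E] [InnerProductSpace ℝ E]

/-- Gordan's alternative: if no convex combination of finitely many vectors vanishes, then some
direction makes an obtuse angle with all of them. -/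
lemma exists_inner_neg_of_sum_ne_zero [FiniteDimensional ℝ E] {ι : Type*} [Fintype ι]
    (I : Finset ι) (a : ι → E)
    (h : ∀ l : ι → ℝ, (∀ i, 0 ≤ l i) → ∑ i ∈ I, l i = 1 → ∑ i ∈ I, l i • a i ≠ 0) :
    ∃ v : E, ∀ i ∈ I, ⟪a i, v⟫_ℝ < 0 := by
  classical
  have hsub : convexHull ℝ (a '' I) ⊆
      {x | ∃ l : ι → ℝ, (∀ i, 0 ≤ l i) ∧ ∑ i ∈ I, l i = 1 ∧ ∑ i ∈ I, l i • a i = x} := by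
    refine convexHull_min ?_ ?_
    · rintro _ ⟨i, hi, rfl⟩
      have hi' : i ∈ I := hi
      refine ⟨Pi.single i 1, fun j => ?_, ?_, ?_⟩
      · by_cases hj : j = i
        · subst hj; simp
        · simp [hj]
      · simp [Pi.single_apply, hi']
      · simp [Pi.single_apply, ite_smul, hi']
    · rintro _ ⟨l, hl, hl1, rfl⟩ _ ⟨k, hk, hk1, rfl⟩ b c hb hc hbc
      refine ⟨fun i => b * l i + c * k i, fun i => ?_, ?_, ?_⟩
      · have := hl i; have := hk i; positivity
      · rw [Finset.sum_add_distrib, ← Finset.mul_sum, ← Finset.mul_sum, hl1, hk1]; linarith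
      · simp only [add_smul, Finset.sum_add_distrib, Finset.smul_sum, mul_smul]
  have h0 : (0 : E) ∉ convexHull ℝ (a '' I) := fun hmem => by
    obtain ⟨l, hl, hl1, hl0⟩ := hsub hmem
    exact h l hl hl1 hl0
  obtain ⟨f, u, hu, hf⟩ := geometric_hahn_banach_point_closed (convex_convexHull ℝ (a '' I))
    ((I.finite_toSet.image a).isCompact_convexHull (𝕜 := ℝ)).isClosed h0
  rw [map_zero] at hu
  refine ⟨-(InnerProductSpace.toDual ℝ E).symm f, fun i hi => ?_⟩
  have := hf _ (subset_convexHull ℝ _ (mem_image_of_mem a hi))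
  rw [inner_neg_right, real_inner_comm, InnerProductSpace.toDual_symm_apply]
  linarith

variable {ι : Type*} {ψ : ι → E → ℝ} {ψ' : ι → E →L[ℝ] ℝ} {x : E}

/-- A direction along which all active constraints strictly decrease is a hypertangent. -/
lemma mem_hypertangentCone_of_fderiv_neg [Finite ι] (hx : x ∈ ⋂ i, {y | ψ i y ≤ 0})
    (hψ : ∀ i, HasStrictFDerivAt (ψ i) (ψ' i) x) {v : E} (hv : ∀ i, ψ i x = 0 → ψ' i v < 0) :
    v ∈ hypertangentCone (⋂ i, {y | ψ i y ≤ 0}) x := by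
  have hmv : Tendsto (fun q : E × E × ℝ => q.1 + q.2.2 • q.2.1)
      (𝓝 x ×ˢ 𝓝 v ×ˢ 𝓝[>] 0) (𝓝 x) := by
    have hs : Tendsto (fun q : E × E × ℝ => q.2.2) (𝓝 x ×ˢ 𝓝 v ×ˢ 𝓝[>] 0) (𝓝 0) :=
      (tendsto_snd.comp tendsto_snd).mono_right nhdsWithin_le_nhds
    simpa using tendsto_fst.add (hs.smul (tendsto_fst.comp tendsto_snd))
  have hall : ∀ i, ∀ᶠ q : E × E × ℝ in 𝓝 x ×ˢ 𝓝 v ×ˢ 𝓝[>] 0,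
      ψ i q.1 ≤ 0 → ψ i (q.1 + q.2.2 • q.2.1) ≤ 0 := by
    intro i
    have hxi : ψ i x ≤ 0 := mem_iInter.1 hx i
    rcases hxi.lt_or_eq with hlt | heq
    · have h1 := (hψ i).continuousAt.eventually_lt continuousAt_const hlt
      exact (hmv.eventually h1).mono fun q hq _ => hq.le
    · have hneg := hv i heq
      obtain ⟨c, hc, hcv⟩ : ∃ c > 0, ψ' i v + c * ‖v‖ < 0 := by
        have : ∀ᶠ c in 𝓝[>] (0 : ℝ), ψ' i v + c * ‖v‖ < 0 := by
          refine Filter.Eventually.filter_mono nhdsWithin_le_nhds ?_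
          exact ContinuousAt.eventually_lt (by fun_prop) continuousAt_const (by simpa using hneg)
        obtain ⟨c, h1, h2⟩ := (this.and self_mem_nhdsWithin).exists
        exact ⟨c, h2, h1⟩
      have h1 : ∀ᶠ w in 𝓝 v, ψ' i w + c * ‖w‖ < 0 :=
        ContinuousAt.eventually_lt (by fun_prop) continuousAt_const hcv
      have h1' := (tendsto_fst.comp (tendsto_snd (f := 𝓝 x)
        (g := 𝓝 v ×ˢ 𝓝[>] (0 : ℝ)))).eventually h1
      have hpos : ∀ᶠ q : E × E × ℝ in 𝓝 x ×ˢ 𝓝 v ×ˢ 𝓝[>] 0, 0 < q.2.2 :=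
        (tendsto_snd.comp tendsto_snd).eventually self_mem_nhdsWithin
      have h2 := (hmv.prodMk_nhds tendsto_fst).eventually ((hψ i).isLittleO.def hc)
      filter_upwards [h1', hpos, h2] with q hq1 hq0 hq2 hq
      simp only [add_sub_cancel_left, map_smul, smul_eq_mul, norm_smul,
        Real.norm_of_nonneg hq0.le] at hq2
      have h3 := (le_abs_self _).trans hq2
      have h4 : q.2.2 * (ψ' i q.2.1 + c * ‖q.2.1‖) ≤ 0 :=
        mul_nonpos_of_nonneg_of_nonpos hq0.le (le_of_lt hq1)
      linarith
  filter_upwards [eventually_all.2 hall] with q hq hqC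
  exact mem_iInter.2 fun i => hq i (mem_iInter.1 hqC i)

/-- A curve that stays in the set has, at a point of differentiability, a velocity that annihilates
the active constraints. -/
lemma fderiv_eq_zero_of_eventually_mem {y : ℝ → E} {y' : E} {t : ℝ}
    (hψ : ∀ i, HasStrictFDerivAt (ψ i) (ψ' i) (y t))
    (hy : ∀ᶠ s in 𝓝 t, y s ∈ ⋂ i, {z | ψ i z ≤ 0}) (hd : HasDerivAt y y' t) {i : ι}
    (hi : ψ i (y t) = 0) : ψ' i y' = 0 := by
  refine IsLocalMax.hasDerivAt_eq_zero (f := ψ i ∘ y) (a := t) ?_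
    ((hψ i).hasFDerivAt.comp_hasDerivAt t hd)
  filter_upwards [hy] with s hs
  simpa [hi] using mem_iInter.1 hs i

/-- The velocity of a viable curve is no longer than that of the perturbation plus the Lipschitz
constant of `φ`: the velocity is tangent to the active constraints in both directions, so the normal
part of the subgradient does no work along it. -/
lemma norm_deriv_le_of_mem_clarkeSubdifferential [Finite ι] {φ : E → EReal}
    (hbot : ∀ x, φ x ≠ ⊥) {K : ℝ≥0}
    (hK : LipschitzOnWith K (fun x => (φ x).toReal) (effDomain φ))
    (hC : effDomain φ = ⋂ i, {z | ψ i z ≤ 0}) {y : ℝ → E} {y' ζ : E} {t : ℝ}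
    (hψ : ∀ i, HasStrictFDerivAt (ψ i) (ψ' i) (y t))
    {v : E} (hv : ∀ i, ψ i (y t) = 0 → ψ' i v < 0)
    (hy : ∀ᶠ s in 𝓝 t, y s ∈ effDomain φ) (hd : HasDerivAt y y' t)
    (hζ : ζ ∈ clarkeSubdifferential φ (y t)) : ‖y'‖ ≤ ‖y' + ζ‖ + K := by
  -- `-y' + ε v` strictly decreases all active constraints, since `y'` annihilates them.
  have key : ∀ ε > 0, ⟪ζ, -y' + ε • v⟫_ℝ ≤ K * ‖-y' + ε • v‖ + ε := by
    intro ε hε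
    have h1 : -y' + ε • v ∈ hypertangentCone (effDomain φ) (y t) := by
      rw [hC]
      refine mem_hypertangentCone_of_fderiv_neg (hC ▸ hζ.1) hψ fun i hi => ?_
      have h2 := fderiv_eq_zero_of_eventually_mem hψ (hC ▸ hy) hd hi
      simp only [map_add, map_neg, h2, map_smul, smul_eq_mul]
      nlinarith [hv i hi]
    have h3 := hζ.2 _ (hypertangentCone_subset_clarkeTangentCone
      (mem_hypertangentCone_epigraph hbot hK h1 (lt_add_of_pos_right _ hε) _))
    dsimp only at h3
    linarith
  have hlim : ⟪ζ, -y'⟫_ℝ ≤ K * ‖-y'‖ := by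
    have h1 : Tendsto (fun ε : ℝ => ⟪ζ, -y' + ε • v⟫_ℝ) (𝓝[>] 0) (𝓝 ⟪ζ, -y'⟫_ℝ) := by
      have : Continuous fun ε : ℝ => ⟪ζ, -y' + ε • v⟫_ℝ := by fun_prop
      simpa using (this.tendsto 0).mono_left nhdsWithin_le_nhds
    have h2 : Tendsto (fun ε : ℝ => K * ‖-y' + ε • v‖ + ε) (𝓝[>] 0) (𝓝 (K * ‖-y'‖)) := by
      have : Continuous fun ε : ℝ => K * ‖-y' + ε • v‖ + ε := by fun_prop
      simpa using (this.tendsto 0).mono_left nhdsWithin_le_nhds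
    exact le_of_tendsto_of_tendsto h1 h2 (eventually_nhdsWithin_of_forall key)
  rw [norm_neg, inner_neg_right] at hlim
  have h1 : ⟪y' + ζ, y'⟫_ℝ ≤ ‖y' + ζ‖ * ‖y'‖ := real_inner_le_norm _ _
  rw [inner_add_left, real_inner_self_eq_norm_sq] at h1
  by_contra! hcon
  have hpos : 0 < ‖y'‖ := lt_of_le_of_lt (by positivity) hcon
  nlinarith

end Inequalities

/-! ### Superposition measurability and Filippov's lemma -/

section Superposition

variable {α : Type*} [MeasurableSpace α] {μ : Measure α}
  {X : Type*} [MetricSpace X] [SecondCountableTopology X] [MeasurableSpace X] [BorelSpace X]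
  {Y : Type*} [TopologicalSpace Y] [TopologicalSpace.PseudoMetrizableSpace Y] [MeasurableSpace Y]
  [BorelSpace Y]

/-- Superposition of a Carathéodory function, defined on a subset `C` in the space variable, with a
measurable function taking values in `C`. -/
lemma aemeasurable_caratheodory_comp {C : Set X} (hne : C.Nonempty) {h : α → X → Y}
    (hmeas : ∀ c ∈ C, AEMeasurable (fun t => h t c) μ) (hcont : ∀ᵐ t ∂μ, ContinuousOn (h t) C)
    {x : α → X} (hx : AEMeasurable x μ) (hxC : ∀ᵐ t ∂μ, x t ∈ C) :
    AEMeasurable (fun t => h t (x t)) μ := by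
  obtain ⟨c₀, hc₀⟩ := hne
  let s : ℕ → SimpleFunc α X := fun k => SimpleFunc.approxOn (hx.mk x) hx.measurable_mk C c₀ hc₀ k
  have hsC : ∀ k t, s k t ∈ C := fun k t => SimpleFunc.approxOn_mem hx.measurable_mk hc₀ k t
  have hs : ∀ k, AEMeasurable (fun t => h t (s k t)) μ := by
    intro k
    have hcov : (⋃ c : (s k).range, s k ⁻¹' {c.1}) = univ := by
      refine eq_univ_of_forall fun t => mem_iUnion.2 ⟨⟨s k t, SimpleFunc.mem_range_self _ t⟩, rfl⟩
    rw [← Measure.restrict_univ (μ := μ), ← hcov, aemeasurable_iUnion_iff]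
    rintro ⟨c, hc⟩
    obtain ⟨t₀, rfl⟩ := SimpleFunc.mem_range.1 hc
    refine (hmeas _ (hsC k t₀)).restrict.congr ?_
    filter_upwards [ae_restrict_mem ((s k).measurableSet_preimage _)] with t ht
    have : s k t = s k t₀ := ht
    rw [this]
  refine aemeasurable_of_tendsto_metrizable_ae atTop hs ?_
  filter_upwards [hcont, hxC, hx.ae_eq_mk] with t ht htC hmk
  have h1 : Tendsto (fun k => s k t) atTop (𝓝 (x t)) := by
    rw [hmk]
    exact SimpleFunc.tendsto_approxOn hx.measurable_mk hc₀ (subset_closure (hmk ▸ htC))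
  exact (ht (x t) htC).tendsto.comp
    (tendsto_nhdsWithin_iff.2 ⟨h1, Eventually.of_forall fun k => hsC k t⟩)

end Superposition

section Filippov

variable {α : Type*} [TopologicalSpace α] [PolishSpace α] [MeasurableSpace α] [BorelSpace α]
  {F : Type*} [MetricSpace F] [CompleteSpace F] [SecondCountableTopology F]
  [MeasurableSpace F] [BorelSpace F]
  {X : Type*} [MetricSpace X] [SecondCountableTopology X] [MeasurableSpace X] [BorelSpace X]

/-- **Filippov's lemma**: a measurable function with values in the images `h t '' U t` is of the form
`h t (v t)` for a measurable selection `v` of `U`. Measurability of `h` is only needed along a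
Castaing representation of `U`, and continuity of `h t` only on `U t`. -/
lemma exists_measurable_selection_eq [Nonempty F] (μ : Measure α) [IsFiniteMeasure μ]
    {U : α → Set F} {G : Set (α × F)} (hG : MeasurableSet G)
    (hGU : ∀ᵐ t ∂μ, ∀ y, (t, y) ∈ G ↔ y ∈ U t) (hcl : ∀ᵐ t ∂μ, IsClosed (U t))
    {u : ℕ → α → F} (hum : ∀ j, Measurable (u j)) (huU : ∀ᵐ t ∂μ, ∀ j, u j t ∈ U t)
    (hud : ∀ᵐ t ∂μ, ∀ y ∈ U t, ∀ ε > 0, ∃ j, dist (u j t) y < ε)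
    {h : α → F → X} (hmeas : ∀ j, AEMeasurable (fun t => h t (u j t)) μ)
    (hcont : ∀ᵐ t ∂μ, ContinuousOn (h t) (U t))
    {p : α → X} (hp : AEMeasurable p μ) (hpU : ∀ᵐ t ∂μ, p t ∈ h t '' U t) :
    ∃ v : α → F, Measurable v ∧ ∀ᵐ t ∂μ, v t ∈ U t ∧ h t (v t) = p t := by
  -- By density of the selections and continuity, `G₁` is the graph of `{y ∈ U t | h t y = p t}`,
  -- written with countably many measurable conditions.
  let G₁ : Set (α × F) := G ∩ ⋂ N : ℕ, ⋃ j : ℕ,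
    {q | dist (u j q.1) q.2 < 1 / ((N : ℝ) + 1)} ∩
      {q | dist ((hmeas j).mk _ q.1) (hp.mk p q.1) < 1 / ((N : ℝ) + 1)}
  have hG₁ : MeasurableSet G₁ := by
    refine hG.inter (MeasurableSet.iInter fun N => MeasurableSet.iUnion fun j =>
      MeasurableSet.inter ?_ ?_)
    · exact measurableSet_lt (((hum j).comp measurable_fst).dist measurable_snd) measurable_const
    · exact measurableSet_lt (((hmeas j).measurable_mk.comp measurable_fst).dist
        (hp.measurable_mk.comp measurable_fst)) measurable_const
  have hiff : ∀ᵐ t ∂μ, ∀ y, (t, y) ∈ G₁ ↔ y ∈ U t ∧ h t y = p t := by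
    filter_upwards [hGU, huU, hud, ae_all_iff.2 fun j => (hmeas j).ae_eq_mk, hp.ae_eq_mk, hcont]
      with t h1 h2 h3 h4 h5 h6 y
    simp only [G₁, mem_inter_iff, mem_iInter, mem_iUnion, mem_ofPred_eq, ← h4, ← h5, h1]
    refine and_congr_right fun hy => ⟨fun hN => ?_, fun hyp N => ?_⟩
    · choose j hj1 hj2 using hN
      have h0 := tendsto_one_div_add_atTop_nhds_zero_nat (𝕜 := ℝ)
      have l1 : Tendsto (fun N => u (j N) t) atTop (𝓝 y) :=
        tendsto_iff_dist_tendsto_zero.2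
          (squeeze_zero (fun _ => dist_nonneg) (fun N => (hj1 N).le) h0)
      have l2 : Tendsto (fun N => h t (u (j N) t)) atTop (𝓝 (p t)) :=
        tendsto_iff_dist_tendsto_zero.2
          (squeeze_zero (fun _ => dist_nonneg) (fun N => (hj2 N).le) h0)
      have l3 : Tendsto (fun N => h t (u (j N) t)) atTop (𝓝 (h t y)) :=
        (h6 y hy).tendsto.comp
          (tendsto_nhdsWithin_iff.2 ⟨l1, Eventually.of_forall fun N => h2 _⟩)
      exact tendsto_nhds_unique l3 l2
    · have hpos : (0 : ℝ) < 1 / ((N : ℝ) + 1) := by positivity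
      obtain ⟨δ, hδ, hcl⟩ := Metric.continuousOn_iff.1 h6 y hy _ hpos
      obtain ⟨j, hj⟩ := h3 y hy (min δ (1 / ((N : ℝ) + 1))) (lt_min hδ hpos)
      refine ⟨j, hj.trans_le (min_le_right _ _), ?_⟩
      rw [← hyp]
      exact hcl _ (h2 j) (hj.trans_le (min_le_left _ _))
  obtain ⟨v, hvm, hv⟩ := exists_measurable_selection_of_ae_nonempty μ hG₁ (by
      filter_upwards [hiff, hpU] with t ht ⟨y, hy, hyp⟩
      exact ⟨y, (ht y).2 ⟨hy, hyp⟩⟩) (by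
      filter_upwards [hiff, hcont, hcl] with t ht htc htcl
      have : {y | (t, y) ∈ G₁} = U t ∩ h t ⁻¹' {p t} := by
        ext y; exact ht y
      rw [this]
      exact htc.preimage_isClosed_of_isClosed htcl isClosed_singleton)
  refine ⟨v, hvm, ?_⟩
  filter_upwards [hiff, hv] with t ht htv
  exact (ht _).1 htv

end Filippov

/-! ### Absolutely continuous curves and almost everywhere differential inequalities -/

section Curves

lemma absolutelyContinuousOnInterval_comp_lipschitzWith {X Y : Type*} [PseudoMetricSpace X]
    [PseudoMetricSpace Y] {f : ℝ → X} {a b : ℝ} (hf : AbsolutelyContinuousOnInterval f a b)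
    {K : ℝ≥0} {L : X → Y} (hL : LipschitzWith K L) :
    AbsolutelyContinuousOnInterval (L ∘ f) a b := by
  have h : Tendsto (fun I : ℕ × (ℕ → ℝ × ℝ) =>
      K * ∑ i ∈ Finset.range I.1, dist (f (I.2 i).1) (f (I.2 i).2))
      (AbsolutelyContinuousOnInterval.totalLengthFilter ⊓
        𝓟 (AbsolutelyContinuousOnInterval.disjWithin a b)) (𝓝 0) := by
    simpa using Tendsto.const_mul (K : ℝ) hf
  refine squeeze_zero (fun I => Finset.sum_nonneg fun i _ => dist_nonneg) (fun I => ?_) h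
  rw [Finset.mul_sum]
  exact Finset.sum_le_sum fun i _ => hL.dist_le_mul _ _

lemma sub_le_mul_of_ae_hasDerivAt_le {q : ℝ → ℝ} {a b s : ℝ} (hab : a ≤ b)
    (hq : AbsolutelyContinuousOnInterval q a b)
    (hd : ∀ᵐ t ∂volume.restrict (Icc a b), ∃ d ≤ s, HasDerivAt q d t) :
    q b - q a ≤ s * (b - a) := by
  rw [← hq.integral_deriv_eq_sub]
  calc ∫ t in a..b, deriv q t ≤ ∫ _ in a..b, s := by
        refine intervalIntegral.integral_mono_ae_restrict hab hq.intervalIntegrable_deriv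
          intervalIntegrable_const ?_
        filter_upwards [hd] with t ⟨d, hds, ht⟩
        rw [ht.deriv]
        exact hds
    _ = s * (b - a) := by rw [intervalIntegral.integral_const, smul_eq_mul, mul_comm]

variable {E : Type*} [NormedAddCommGroup E] [InnerProductSpace ℝ E]

lemma inner_sub_le_mul_of_ae_hasDerivAt {y : ℝ → E} {a b s : ℝ} (hab : a ≤ b)
    (hy : AbsolutelyContinuousOnInterval y a b) (e : E)
    (hd : ∀ᵐ t ∂volume.restrict (Icc a b), ∃ d, HasDerivAt y d t ∧ ⟪d, e⟫_ℝ ≤ s) :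
    ⟪y b - y a, e⟫_ℝ ≤ s * (b - a) := by
  have h1 := sub_le_mul_of_ae_hasDerivAt_le (q := innerSL ℝ e ∘ y) hab
    (absolutelyContinuousOnInterval_comp_lipschitzWith hy (innerSL ℝ e).lipschitz) (s := s) (by
      filter_upwards [hd] with t ⟨d, hdt, hds⟩
      refine ⟨innerSL ℝ e d, ?_, (innerSL ℝ e).hasFDerivAt.comp_hasDerivAt t hdt⟩
      simpa [real_inner_comm] using hds)
  simpa [inner_sub_left, real_inner_comm] using h1

lemma lipschitzOnWith_of_ae_norm_deriv_le {y : ℝ → E} {a b : ℝ} (hab : a ≤ b)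
    (hy : AbsolutelyContinuousOnInterval y a b) {L : ℝ≥0}
    (hd : ∀ᵐ t ∂volume.restrict (Icc a b), ∃ d, HasDerivAt y d t ∧ ‖d‖ ≤ L) :
    LipschitzOnWith L y (Icc a b) := by
  have key : ∀ s ∈ Icc a b, ∀ t ∈ Icc a b, s ≤ t → dist (y t) (y s) ≤ L * dist t s := by
    intro s hs t ht hst
    have hsub : Icc s t ⊆ Icc a b := Icc_subset_Icc hs.1 ht.2
    have h1 := inner_sub_le_mul_of_ae_hasDerivAt (s := L * ‖y t - y s‖) hst
      (hy.mono (by rwa [uIcc_of_le hst, uIcc_of_le hab])) (y t - y s) (by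
        filter_upwards [ae_restrict_of_ae_restrict_of_subset hsub hd] with τ ⟨d, hdτ, hdL⟩
        exact ⟨d, hdτ, (real_inner_le_norm _ _).trans (by gcongr)⟩)
    rw [real_inner_self_eq_norm_sq] at h1
    rw [dist_eq_norm, Real.dist_eq, abs_of_nonneg (sub_nonneg.2 hst)]
    by_contra! hcon
    have hst' : 0 ≤ t - s := sub_nonneg.2 hst
    have hpos : 0 < ‖y t - y s‖ := lt_of_le_of_lt (by positivity) hcon
    nlinarith
  refine LipschitzOnWith.of_dist_le_mul fun s hs t ht => ?_
  rcases le_total s t with h | h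
  · rw [dist_comm, dist_comm s]
    exact key s hs t ht h
  · exact key t ht s hs h

lemma nonneg_of_hasDerivAt_of_eventually_le {q : ℝ → ℝ} {d t : ℝ} (hq : HasDerivAt q d t)
    (h : ∀ᶠ s in 𝓝[>] t, q t ≤ q s) : 0 ≤ d := by
  have h1 := (hasDerivWithinAt_iff_tendsto_slope' (s := Ioi t) self_notMem_Ioi).1
    hq.hasDerivWithinAt
  refine ge_of_tendsto h1 ?_
  filter_upwards [h, self_mem_nhdsWithin] with s hs hts
  rw [slope_def_field]
  exact div_nonneg (sub_nonneg.2 hs) (sub_nonneg.2 (le_of_lt hts))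

lemma ae_restrict_Icc_mem_Ioo (a b : ℝ) : ∀ᵐ t ∂volume.restrict (Icc a b), t ∈ Ioo a b := by
  rw [← restrict_Ioo_eq_restrict_Icc]
  exact ae_restrict_mem measurableSet_Ioo

/-- If the increments of `q` are bounded by the integrals of `σ`, then the derivative of `q` is
bounded by `σ` almost everywhere (Lebesgue's differentiation theorem). -/
lemma ae_hasDerivAt_le_of_sub_le_integral {q σ : ℝ → ℝ} {a b : ℝ} (hab : a ≤ b)
    (hσ : IntervalIntegrable σ volume a b)
    (h : ∀ s t, a ≤ s → s ≤ t → t ≤ b → q t - q s ≤ ∫ τ in s..t, σ τ) :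
    ∀ᵐ t ∂volume.restrict (Icc a b), ∀ d, HasDerivAt q d t → d ≤ σ t := by
  have h1 := hσ.ae_hasDerivAt_integral
  rw [uIcc_of_le hab] at h1
  filter_upwards [ae_restrict_of_ae h1, ae_restrict_Icc_mem_Ioo a b] with t ht htm d hd
  have h2 := (ht (Ioo_subset_Icc_self htm) a (left_mem_Icc.2 hab)).sub hd
  refine sub_nonneg.1 (nonneg_of_hasDerivAt_of_eventually_le h2 ?_)
  filter_upwards [Ioo_mem_nhdsGT htm.2] with s hs
  have h3 : ∀ c ∈ Icc a b, IntervalIntegrable σ volume a c := fun c hc =>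
    hσ.mono_set (by rw [uIcc_of_le hab, uIcc_of_le hc.1]; exact Icc_subset_Icc_right hc.2)
  have h4 := intervalIntegral.integral_interval_sub_left (h3 s ⟨htm.1.le.trans hs.1.le, hs.2.le⟩)
    (h3 t (Ioo_subset_Icc_self htm))
  have h5 := h t s htm.1.le hs.1.le hs.2.le
  simp only [Pi.sub_apply]
  linarith

lemma lipschitzOnWith_integral {T : ℝ} {M : ℝ≥0} {p : ℝ → E}
    (hp : IntervalIntegrable p volume 0 T) (hT : 0 ≤ T)
    (hM : ∀ᵐ t ∂volume.restrict (Icc 0 T), ‖p t‖ ≤ M) :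
    LipschitzOnWith M (fun t => ∫ τ in (0 : ℝ)..t, p τ) (Icc 0 T) := by
  have hint : ∀ c ∈ Icc 0 T, IntervalIntegrable p volume 0 c := fun c hc =>
    hp.mono_set (by rw [uIcc_of_le hT, uIcc_of_le hc.1]; exact Icc_subset_Icc_right hc.2)
  refine LipschitzOnWith.of_dist_le_mul fun s hs t ht => ?_
  rw [dist_eq_norm, intervalIntegral.integral_interval_sub_left (hint s hs) (hint t ht),
    Real.dist_eq]
  refine intervalIntegral.norm_integral_le_of_norm_le_const_ae ?_
  filter_upwards [(ae_restrict_iff' measurableSet_Icc).1 hM] with τ hτ hmem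
  refine hτ ((uIoc_subset_uIcc.trans (uIcc_subset_Icc ht hs)) hmem)

/-- A bounded closed convex set contains every point that satisfies the support inequalities in a
dense set of directions. -/
lemma mem_of_forall_inner_le_of_dense [CompleteSpace E] {K : Set E} (hconv : Convex ℝ K)
    (hcl : IsClosed K) {M : ℝ} (hM : ∀ y ∈ K, ‖y‖ ≤ M) (hM0 : 0 ≤ M) {D : Set E} (hD : Dense D)
    {p : E} (hp : ∀ e ∈ D, ∀ c, (∀ y ∈ K, ⟪y, e⟫_ℝ ≤ c) → ⟪p, e⟫_ℝ ≤ c) : p ∈ K := by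
  by_contra hpK
  obtain ⟨f, s, hf, hs⟩ := geometric_hahn_banach_closed_point hconv hcl hpK
  set e₀ := (InnerProductSpace.toDual ℝ E).symm f with he₀
  have hfe : ∀ y, f y = ⟪y, e₀⟫_ℝ := fun y => by
    rw [real_inner_comm, he₀, InnerProductSpace.toDual_symm_apply]
  have hδ : 0 < (f p - s) / (M + ‖p‖ + 1) := div_pos (sub_pos.2 hs) (by positivity)
  obtain ⟨e, heD, he⟩ := hD.exists_dist_lt e₀ hδ
  rw [dist_comm, dist_eq_norm, lt_div_iff₀ (by positivity)] at he
  have h1 : ∀ y, |⟪y, e⟫_ℝ - f y| ≤ ‖y‖ * ‖e - e₀‖ := fun y => by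
    rw [hfe, ← inner_sub_right]
    exact abs_real_inner_le_norm _ _
  have h2 := hp e heD (s + M * ‖e - e₀‖) fun y hy => by
    have h3 := (abs_le.1 (h1 y)).2
    have h4 := hf y hy
    have h5 : ‖y‖ * ‖e - e₀‖ ≤ M * ‖e - e₀‖ :=
      mul_le_mul_of_nonneg_right (hM y hy) (norm_nonneg _)
    linarith
  have h3 := (abs_le.1 (h1 p)).1
  nlinarith [norm_nonneg (e - e₀)]

/-- **Arzelà–Ascoli** for equi-Lipschitz curves in a compact set. -/
lemma exists_subseq_tendsto_of_lipschitzOnWith {X : Type*} [MetricSpace X] {a b : ℝ} (hab : a ≤ b)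
    {K : Set X} (hK : IsCompact K) {L : ℝ≥0} {z : ℕ → ℝ → X}
    (hz : ∀ k, LipschitzOnWith L (z k) (Icc a b)) (hzK : ∀ k, ∀ t ∈ Icc a b, z k t ∈ K) :
    ∃ (σ : ℕ → ℕ) (w : ℝ → X), StrictMono σ ∧ LipschitzOnWith L w (Icc a b) ∧
      ∀ t ∈ Icc a b, Tendsto (fun k => z (σ k) t) atTop (𝓝 (w t)) := by
  let Z : ℕ → BoundedContinuousFunction (Icc a b) X := fun k =>
    BoundedContinuousFunction.mkOfCompact
      ⟨(Icc a b).domRestrict (z k), (hz k).continuousOn.domRestrict⟩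
  have hZ : ∀ k (t : Icc a b), Z k t = z k t := fun k t => rfl
  have hcomp : IsCompact (closure (range Z)) := by
    refine BoundedContinuousFunction.arzela_ascoli K hK _ ?_ ?_
    · rintro _ t ⟨k, rfl⟩
      exact hzK k t t.2
    · refine (LipschitzWith.uniformEquicontinuous _ L ?_).equicontinuous
      rintro ⟨_, k, rfl⟩
      exact (hz k).to_restrict
  obtain ⟨w, -, σ, hσ, hw⟩ := hcomp.tendsto_subseq fun k => subset_closure (mem_range_self k)
  have hpt : ∀ t : Icc a b, Tendsto (fun k => z (σ k) t) atTop (𝓝 (w t)) := fun t =>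
    (BoundedContinuousFunction.tendsto_iff_tendstoUniformly.1 hw).tendsto_at t
  have hext : ∀ t (ht : t ∈ Icc a b), w (projIcc a b hab t) = w ⟨t, ht⟩ := fun t ht => by
    rw [projIcc_of_mem hab ht]
  refine ⟨σ, fun t => w (projIcc a b hab t), hσ, ?_, fun t ht => ?_⟩
  · refine LipschitzOnWith.of_dist_le_mul fun s hs t ht => ?_
    rw [hext s hs, hext t ht]
    exact le_of_tendsto' ((hpt ⟨s, hs⟩).dist (hpt ⟨t, ht⟩)) fun k =>
      (hz (σ k)).dist_le_mul s hs t ht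
  · dsimp only
    rw [hext t ht]
    exact hpt ⟨t, ht⟩

end Curves

/-! ### Limits of velocities -/

section Limits

variable {E : Type*} [NormedAddCommGroup E] [InnerProductSpace ℝ E]

/-- The differential inclusion `Z' ∈ ∂φ(x)` passes to pointwise limits. Near a time `t`, all
subgradients of the approximating curves satisfy, up to an error, the inequality that a given
tangent direction imposes at `x t`; averaging over short intervals transfers it to the limit. -/
lemma mem_clarkeSubdifferential_of_tendsto {φ : E → EReal} (hbot : ∀ x, φ x ≠ ⊥) {K : ℝ≥0}
    (hK : LipschitzOnWith K (fun x => (φ x).toReal) (effDomain φ)) {a b : ℝ}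
    {x : ℝ → E} {xs : ℕ → ℝ → E} {Z : ℝ → E} {Zs : ℕ → ℝ → E} {L : ℝ≥0}
    (hxs : ∀ k, LipschitzOnWith L (xs k) (Icc a b))
    (hx : ∀ t ∈ Icc a b, Tendsto (fun k => xs k t) atTop (𝓝 (x t)))
    (hZs : ∀ k, AbsolutelyContinuousOnInterval (Zs k) a b)
    (hZ : ∀ t ∈ Icc a b, Tendsto (fun k => Zs k t) atTop (𝓝 (Z t)))
    (hd : ∀ k, ∀ᵐ t ∂volume.restrict (Icc a b),
      ∃ ζ ∈ clarkeSubdifferential φ (xs k t), HasDerivAt (Zs k) ζ t)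
    {t : ℝ} (ht : t ∈ Ioo a b) {v ζ : E} (hxt : x t ∈ effDomain φ)
    (hv : v ∈ hypertangentCone (effDomain φ) (x t)) (hζ : HasDerivAt Z ζ t) :
    ζ ∈ clarkeSubdifferential φ (x t) := by
  refine ⟨hxt, fun p hp => ?_⟩
  have key : ∀ ε > 0, ⟪ζ, p.1 + ε • v⟫_ℝ ≤ p.2 + ε * (K * ‖v‖ + 1) := by
    intro ε hε
    set e := p.1 + ε • v
    set c := p.2 + ε * (K * ‖v‖ + 1)
    obtain ⟨r, hr, hball⟩ := Metric.eventually_nhds_iff.1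
      (eventually_inner_le_of_mem_clarkeSubdifferential hbot hK hxt hv hp hε)
    have hnear : ∀ᶠ s in 𝓝[>] t, L * (s - t) < r / 2 := by
      refine Filter.Eventually.filter_mono nhdsWithin_le_nhds ?_
      exact ContinuousAt.eventually_lt (by fun_prop) continuousAt_const (by simpa using half_pos hr)
    have hq : HasDerivAt (fun s => c * s - innerSL ℝ e (Z s)) (c * 1 - innerSL ℝ e ζ) t :=
      ((hasDerivAt_id t).const_mul c).sub ((innerSL ℝ e).hasFDerivAt.comp_hasDerivAt t hζ)
    have h0 : 0 ≤ c * 1 - innerSL ℝ e ζ := by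
      refine nonneg_of_hasDerivAt_of_eventually_le hq ?_
      filter_upwards [hnear, Ioo_mem_nhdsGT ht.2] with s hs hsb
      have hts : t ∈ Icc a b := Ioo_subset_Icc_self ht
      have hss : s ∈ Icc a b := ⟨ht.1.le.trans hsb.1.le, hsb.2.le⟩
      have hsub : Icc t s ⊆ Icc a b := Icc_subset_Icc hts.1 hss.2
      have hlim : Tendsto (fun k => ⟪Zs k s - Zs k t, e⟫_ℝ) atTop (𝓝 ⟪Z s - Z t, e⟫_ℝ) :=
        ((hZ s hss).sub (hZ t hts)).inner tendsto_const_nhds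
      have hle : ⟪Z s - Z t, e⟫_ℝ ≤ c * (s - t) := by
        refine le_of_tendsto hlim ?_
        filter_upwards [Metric.tendsto_nhds.1 (hx t hts) (r / 2) (half_pos hr)] with k hk
        refine inner_sub_le_mul_of_ae_hasDerivAt hsb.1.le ((hZs k).mono ?_) e ?_
        · rwa [uIcc_of_le hsb.1.le, uIcc_of_le (hts.1.trans hts.2)]
        · filter_upwards [ae_restrict_of_ae_restrict_of_subset hsub (hd k),
            ae_restrict_mem measurableSet_Icc] with τ ⟨ξ, hξ, hξd⟩ hτ
          refine ⟨ξ, hξd, hball ?_ ξ hξ⟩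
          have h1 := (hxs k).dist_le_mul τ (hsub hτ) t hts
          have h2 : (L : ℝ) * dist τ t ≤ L * (s - t) := by
            rw [Real.dist_eq, abs_of_nonneg (sub_nonneg.2 hτ.1)]
            gcongr
            exact hτ.2
          linarith [dist_triangle (xs k τ) (xs k t) (x t)]
      simp only [innerSL_apply_apply]
      rw [real_inner_comm, inner_sub_right] at hle
      linarith
    rw [innerSL_apply_apply, real_inner_comm] at h0
    linarith
  have h1 : Tendsto (fun ε : ℝ => ⟪ζ, p.1 + ε • v⟫_ℝ) (𝓝[>] 0) (𝓝 ⟪ζ, p.1⟫_ℝ) := by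
    have : Continuous fun ε : ℝ => ⟪ζ, p.1 + ε • v⟫_ℝ := by fun_prop
    simpa using (this.tendsto 0).mono_left nhdsWithin_le_nhds
  have h2 : Tendsto (fun ε : ℝ => p.2 + ε * (K * ‖v‖ + 1)) (𝓝[>] 0) (𝓝 p.2) := by
    have : Continuous fun ε : ℝ => p.2 + ε * (K * ‖v‖ + 1) := by fun_prop
    simpa using (this.tendsto 0).mono_left nhdsWithin_le_nhds
  have := le_of_tendsto_of_tendsto h1 h2 (eventually_nhdsWithin_of_forall key)
  linarith

variable [FiniteDimensional ℝ E] [MeasurableSpace E] [BorelSpace E]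
  {F : Type*} [MetricSpace F]

/-- A curve whose increments are controlled, in every direction `e`, by the integrals of all upper
bounds of the support function of the compact convex sets `h t '' U t` has its derivative in these
sets. The support function itself is an admissible bound: along a Castaing representation of `U` it
is a countable supremum, hence measurable. -/
lemma ae_deriv_mem_image {T M : ℝ} (hT : 0 ≤ T) (hM : 0 ≤ M) {P : ℝ → E} {U : ℝ → Set F}
    {h : ℝ → F → E} {u : ℕ → ℝ → F} (huU : ∀ᵐ t ∂volume.restrict (Icc 0 T), ∀ j, u j t ∈ U t)
    (hud : ∀ᵐ t ∂volume.restrict (Icc 0 T), ∀ y ∈ U t, ∀ ε > 0, ∃ j, dist (u j t) y < ε)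
    (hmeas : ∀ j, AEMeasurable (fun t => h t (u j t)) (volume.restrict (Icc 0 T)))
    (hcont : ∀ᵐ t ∂volume.restrict (Icc 0 T), ContinuousOn (h t) (U t))
    (hcpt : ∀ᵐ t ∂volume.restrict (Icc 0 T), IsCompact (U t))
    (hbd : ∀ᵐ t ∂volume.restrict (Icc 0 T), ∀ y ∈ U t, ‖h t y‖ ≤ M)
    (hconv : ∀ᵐ t ∂volume.restrict (Icc 0 T), Convex ℝ (h t '' U t))
    (hPd : ∀ᵐ t ∂volume.restrict (Icc 0 T), DifferentiableAt ℝ P t)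
    (hP : ∀ (e : E) (σ : ℝ → ℝ), IntervalIntegrable σ volume 0 T →
      (∀ᵐ t ∂volume.restrict (Icc 0 T), ∀ y ∈ U t, ⟪h t y, e⟫_ℝ ≤ σ t) →
      ∀ s t, 0 ≤ s → s ≤ t → t ≤ T → ⟪P t - P s, e⟫_ℝ ≤ ∫ τ in s..t, σ τ) :
    ∀ᵐ t ∂volume.restrict (Icc 0 T), deriv P t ∈ h t '' U t := by
  have dir : ∀ e : E, ∀ᵐ t ∂volume.restrict (Icc 0 T), ∀ c,
      (∀ y ∈ h t '' U t, ⟪y, e⟫_ℝ ≤ c) → ⟪deriv P t, e⟫_ℝ ≤ c := by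
    intro e
    let σ : ℝ → ℝ := fun t => ⨆ j, ⟪h t (u j t), e⟫_ℝ
    have hσm : AEMeasurable σ (volume.restrict (Icc 0 T)) :=
      AEMeasurable.iSup fun j => (hmeas j).inner aemeasurable_const
    have habs : ∀ᵐ t ∂volume.restrict (Icc 0 T), ∀ j, |⟪h t (u j t), e⟫_ℝ| ≤ M * ‖e‖ := by
      filter_upwards [huU, hbd] with t h1 h2 j
      exact (abs_real_inner_le_norm _ _).trans
        (mul_le_mul_of_nonneg_right (h2 _ (h1 j)) (norm_nonneg _))
    have hbdd : ∀ᵐ t ∂volume.restrict (Icc 0 T), BddAbove (range fun j => ⟪h t (u j t), e⟫_ℝ) := by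
      filter_upwards [habs] with t ht
      exact ⟨M * ‖e‖, by rintro _ ⟨j, rfl⟩; exact (abs_le.1 (ht j)).2⟩
    have hσi : IntervalIntegrable σ volume 0 T := by
      rw [intervalIntegrable_iff_integrableOn_Icc_of_le hT]
      refine Integrable.of_bound hσm.aestronglyMeasurable (M * ‖e‖) ?_
      filter_upwards [habs, hbdd] with t h1 h2
      refine abs_le.2 ⟨(abs_le.1 (h1 0)).1.trans (le_ciSup h2 0), ciSup_le fun j => ?_⟩
      exact (abs_le.1 (h1 j)).2
    have hσle : ∀ᵐ t ∂volume.restrict (Icc 0 T), ∀ y ∈ U t, ⟪h t y, e⟫_ℝ ≤ σ t := by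
      filter_upwards [huU, hud, hcont, hbdd] with t h1 h2 h3 h4 y hy
      have hfreq : (𝓝[range fun j => u j t] y).NeBot := by
        refine mem_closure_iff_nhdsWithin_neBot.1 (Metric.mem_closure_iff.2 fun ε hε => ?_)
        obtain ⟨j, hj⟩ := h2 y hy ε hε
        exact ⟨_, mem_range_self j, by rwa [dist_comm]⟩
      have hsub : (range fun j => u j t) ⊆ U t := by rintro _ ⟨j, rfl⟩; exact h1 j
      have hlim : Tendsto (fun w => ⟪h t w, e⟫_ℝ) (𝓝[range fun j => u j t] y) (𝓝 ⟪h t y, e⟫_ℝ) :=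
        (((h3 y hy).mono hsub).tendsto).inner tendsto_const_nhds
      refine le_of_tendsto hlim ?_
      filter_upwards [self_mem_nhdsWithin] with w hw
      obtain ⟨j, rfl⟩ := hw
      exact le_ciSup h4 j
    have hder := ae_hasDerivAt_le_of_sub_le_integral (q := fun t => innerSL ℝ e (P t)) hT hσi
      fun s t hs hst ht => by
        have := hP e σ hσi hσle s t hs hst ht
        rw [real_inner_comm, inner_sub_right] at this
        simpa using this
    filter_upwards [hder, hPd, huU] with t h1 h2 h3 c hc
    have h4 := h1 _ ((innerSL ℝ e).hasFDerivAt.comp_hasDerivAt t h2.hasDerivAt)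
    rw [innerSL_apply_apply, real_inner_comm] at h4
    exact h4.trans (ciSup_le fun j => hc _ (mem_image_of_mem _ (h3 j)))
  have hall := ae_all_iff.2 fun i => dir (TopologicalSpace.denseSeq E i)
  filter_upwards [hall, hcont, hcpt, hbd, hconv] with t h1 h2 h3 h4 h5
  refine mem_of_forall_inner_le_of_dense h5 (h3.image_of_continuousOn h2).isClosed (M := M) ?_ hM
    (TopologicalSpace.denseRange_denseSeq E) ?_
  · rintro _ ⟨y, hy, rfl⟩
    exact h4 y hy
  · rintro _ ⟨i, rfl⟩ c hc
    exact h1 i c hc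

/-- An almost everywhere bounded measurable function is interval integrable. -/
lemma intervalIntegrable_of_ae_norm_le {T M : ℝ} (hT : 0 ≤ T) {p : ℝ → E}
    (hp : AEMeasurable p (volume.restrict (Icc 0 T)))
    (hM : ∀ᵐ t ∂volume.restrict (Icc 0 T), ‖p t‖ ≤ M) : IntervalIntegrable p volume 0 T := by
  rw [intervalIntegrable_iff_integrableOn_Icc_of_le hT]
  exact Integrable.of_bound hp.aestronglyMeasurable M hM

end Limits

/-! ### Compactness of the set of admissible trajectories -/

section Admissible

variable {E : Type*} [NormedAddCommGroup E] [InnerProductSpace ℝ E]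
  {F : Type*} [MeasurableSpace F] {T : ℝ} {f : ℝ → E → F → E} {φ : E → EReal} {C₀ CT : Set E}
  {U : ℝ → Set F} {x : ℝ → E} {u : ℝ → F}

lemma IsAdmissible.mem_effDomain (h : IsAdmissible T f φ C₀ CT U x u) (hT : 0 < T)
    (hcl : IsClosed (effDomain φ)) (hne : (effDomain φ).Nonempty) :
    ∀ t ∈ Icc 0 T, x t ∈ effDomain φ := by
  have hx : ContinuousOn x (Icc 0 T) := by
    simpa [uIcc_of_le hT.le] using h.absCont.continuousOn
  have heq : EqOn (fun t => Metric.infDist (x t) (effDomain φ)) 0 (Icc 0 T) := by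
    refine Measure.eqOn_Icc_of_ae_eq volume hT.ne ?_
      ((Metric.continuous_infDist_pt _).comp_continuousOn hx) continuousOn_const
    filter_upwards [h.dynamics] with t ⟨ζ, hζ, _⟩
    exact Metric.infDist_zero_of_mem hζ.1
  exact fun t ht => (hcl.mem_iff_infDist_zero hne).2 (heq ht)

/-- Admissible trajectories are Lipschitz with a common constant, given the bound `hvel` on the
velocity of viable curves. -/
lemma IsAdmissible.lipschitzOnWith (h : IsAdmissible T f φ C₀ CT U x u) (hT : 0 < T)
    (hx : ∀ t ∈ Icc 0 T, x t ∈ effDomain φ) {M K : ℝ≥0}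
    (hbd : ∀ᵐ t ∂volume.restrict (Icc 0 T), ∀ c ∈ effDomain φ, ∀ w ∈ U t, ‖f t c w‖ ≤ M)
    (hvel : ∀ (y : ℝ → E) (y' ζ : E) (t : ℝ), (∀ᶠ s in 𝓝 t, y s ∈ effDomain φ) →
      HasDerivAt y y' t → ζ ∈ clarkeSubdifferential φ (y t) → ‖y'‖ ≤ ‖y' + ζ‖ + K) :
    LipschitzOnWith (M + K) x (Icc 0 T) := by
  refine lipschitzOnWith_of_ae_norm_deriv_le hT.le h.absCont ?_
  filter_upwards [h.dynamics, h.control.2, hbd, ae_restrict_Icc_mem_Ioo 0 T]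
    with t ⟨ζ, hζ, hd⟩ hu hM ht
  refine ⟨_, hd, ?_⟩
  have h1 : ∀ᶠ s in 𝓝 t, x s ∈ effDomain φ := by
    filter_upwards [Icc_mem_nhds ht.1 ht.2] with s hs using hx s hs
  have h2 := hvel x _ ζ t h1 hd hζ
  rw [sub_add_cancel] at h2
  have h3 := hM _ (hx t (Ioo_subset_Icc_self ht)) _ hu
  rw [NNReal.coe_add]
  linarith

end Admissible

section SupportInequality

variable {E : Type*} [NormedAddCommGroup E] [InnerProductSpace ℝ E] [FiniteDimensional ℝ E]
  {F : Type*} {T : ℝ} {f : ℝ → E → F → E} {U : ℝ → Set F}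

/-- The integral inequality of the support function passes to the limit in the perturbation. -/
lemma inner_sub_le_integral_of_tendsto (hT : 0 ≤ T) {C : Set E} {D : ℝ} {M L : ℝ≥0}
    (hlip : ∀ᵐ t ∂volume.restrict (Icc 0 T), ∀ w ∈ U t, LipschitzOnWith M (fun c => f t c w) C)
    {xs : ℕ → ℝ → E} {us : ℕ → ℝ → F} {x : ℝ → E} {P : ℝ → E}
    (hus : ∀ k, ∀ᵐ t ∂volume.restrict (Icc 0 T), us k t ∈ U t)
    (hxs : ∀ k, LipschitzOnWith L (xs k) (Icc 0 T)) (hx : LipschitzOnWith L x (Icc 0 T))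
    (hxsC : ∀ k, ∀ t ∈ Icc 0 T, xs k t ∈ C) (hxC : ∀ t ∈ Icc 0 T, x t ∈ C)
    (hD : ∀ y ∈ C, ∀ z ∈ C, ‖y - z‖ ≤ D)
    (hlim : ∀ t ∈ Icc 0 T, Tendsto (fun k => xs k t) atTop (𝓝 (x t)))
    (hint : ∀ k, IntervalIntegrable (fun t => f t (xs k t) (us k t)) volume 0 T)
    (hP : ∀ t ∈ Icc 0 T,
      Tendsto (fun k => ∫ τ in (0 : ℝ)..t, f τ (xs k τ) (us k τ)) atTop (𝓝 (P t)))
    (e : E) {σ : ℝ → ℝ} (hσ : IntervalIntegrable σ volume 0 T)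
    (hσU : ∀ᵐ t ∂volume.restrict (Icc 0 T), ∀ w ∈ U t, ⟪f t (x t) w, e⟫_ℝ ≤ σ t)
    {s t : ℝ} (hs : 0 ≤ s) (hst : s ≤ t) (ht : t ≤ T) :
    ⟪P t - P s, e⟫_ℝ ≤ ∫ τ in s..t, σ τ := by
  have hsub : Icc s t ⊆ Icc 0 T := Icc_subset_Icc hs ht
  have hsub' : uIcc s t ⊆ uIcc 0 T := by rwa [uIcc_of_le hst, uIcc_of_le hT]
  have hsm : s ∈ Icc 0 T := ⟨hs, hst.trans ht⟩
  have htm : t ∈ Icc 0 T := ⟨hs.trans hst, ht⟩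
  have hdc : ∀ k, ContinuousOn (fun τ => ‖xs k τ - x τ‖) (Icc 0 T) := fun k =>
    ((hxs k).continuousOn.sub hx.continuousOn).norm
  have hdi : ∀ k, IntervalIntegrable (fun τ => ‖xs k τ - x τ‖) volume s t := fun k =>
    ((hdc k).mono (by rwa [uIcc_of_le hst])).intervalIntegrable
  have hσi : IntervalIntegrable σ volume s t := hσ.mono_set hsub'
  have hk : ∀ k, ⟪(∫ τ in (0 : ℝ)..t, f τ (xs k τ) (us k τ)) -
      ∫ τ in (0 : ℝ)..s, f τ (xs k τ) (us k τ), e⟫_ℝ ≤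
      (∫ τ in s..t, σ τ) + M * ‖e‖ * ∫ τ in s..t, ‖xs k τ - x τ‖ := by
    intro k
    have hi : ∀ c ∈ Icc 0 T, IntervalIntegrable (fun t => f t (xs k t) (us k t)) volume 0 c :=
      fun c hc => (hint k).mono_set (by
        rw [uIcc_of_le hT, uIcc_of_le hc.1]; exact Icc_subset_Icc_right hc.2)
    have hi' := (hint k).mono_set hsub'
    rw [intervalIntegral.integral_interval_sub_left (hi t htm) (hi s hsm), real_inner_comm,
      ← innerSL_apply_apply ℝ, ← ContinuousLinearMap.intervalIntegral_comp_comm _ hi',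
      ← intervalIntegral.integral_const_mul,
      ← intervalIntegral.integral_add hσi ((hdi k).const_mul _)]
    refine intervalIntegral.integral_mono_ae_restrict hst
      ⟨(innerSL ℝ e).integrable_comp hi'.1, (innerSL ℝ e).integrable_comp hi'.2⟩
      (hσi.add ((hdi k).const_mul _)) ?_
    filter_upwards [ae_restrict_of_ae_restrict_of_subset hsub hlip,
      ae_restrict_of_ae_restrict_of_subset hsub (hus k),
      ae_restrict_of_ae_restrict_of_subset hsub hσU,
      ae_restrict_mem measurableSet_Icc] with τ h1 h2 h3 h4
    have h5 := (h1 _ h2).dist_le_mul _ (hxsC k τ (hsub h4)) _ (hxC τ (hsub h4))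
    rw [dist_eq_norm, dist_eq_norm] at h5
    have h6 := h3 _ h2
    have h7 := real_inner_le_norm (f τ (xs k τ) (us k τ) - f τ (x τ) (us k τ)) e
    rw [inner_sub_left] at h7
    have h8 := mul_le_mul_of_nonneg_right h5 (norm_nonneg e)
    rw [innerSL_apply_apply, real_inner_comm]
    linarith
  have hdist : Tendsto (fun k => ∫ τ in s..t, ‖xs k τ - x τ‖) atTop (𝓝 (∫ _ in s..t, (0 : ℝ))) := by
    have hmem : ∀ τ ∈ uIoc s t, τ ∈ Icc 0 T := fun τ hτ => by
      rw [uIoc_of_le hst] at hτ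
      exact hsub (Ioc_subset_Icc_self hτ)
    refine intervalIntegral.tendsto_integral_filter_of_dominated_convergence (fun _ => D)
      (Eventually.of_forall fun k => ?_) (Eventually.of_forall fun k => ?_)
      intervalIntegrable_const ?_
    · exact (intervalIntegrable_iff.1 (hdi k)).aestronglyMeasurable
    · refine Eventually.of_forall fun τ hτ => ?_
      rw [norm_norm]
      exact hD _ (hxsC k τ (hmem τ hτ)) _ (hxC τ (hmem τ hτ))
    · refine Eventually.of_forall fun τ hτ => ?_
      exact tendsto_iff_norm_sub_tendsto_zero.1 (hlim τ (hmem τ hτ))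
  have hright : Tendsto (fun k => (∫ τ in s..t, σ τ) + M * ‖e‖ * ∫ τ in s..t, ‖xs k τ - x τ‖)
      atTop (𝓝 (∫ τ in s..t, σ τ)) := by
    simpa using tendsto_const_nhds.add (hdist.const_mul (M * ‖e‖))
  exact le_of_tendsto_of_tendsto' (((hP t htm).sub (hP s hsm)).inner tendsto_const_nhds) hright hk

end SupportInequality

section Closure

variable {E : Type*} [NormedAddCommGroup E] [InnerProductSpace ℝ E] [FiniteDimensional ℝ E]
  [MeasurableSpace E] [BorelSpace E]
  {F : Type*} [NormedAddCommGroup F] [ProperSpace F] [MeasurableSpace F] [BorelSpace F]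
  {T : ℝ} {f : ℝ → E → F → E} {φ : E → EReal} {C₀ CT : Set E} {U : ℝ → Set F}

/-- The set of end points of admissible trajectories is sequentially closed. The constraint
qualification enters only through the existence of hypertangents `hhyp` and the velocity bound
`hvel`. -/
theorem exists_isAdmissible_of_tendsto (hT : 0 < T) (hbot : ∀ c, φ c ≠ ⊥) {K M : ℝ≥0}
    (hK : LipschitzOnWith K (fun c => (φ c).toReal) (effDomain φ))
    (hcpt : IsCompact (effDomain φ)) (hne : (effDomain φ).Nonempty)
    (hhyp : ∀ c ∈ effDomain φ, ∃ v, v ∈ hypertangentCone (effDomain φ) c)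
    (hvel : ∀ (y : ℝ → E) (y' ζ : E) (t : ℝ), (∀ᶠ s in 𝓝 t, y s ∈ effDomain φ) →
      HasDerivAt y y' t → ζ ∈ clarkeSubdifferential φ (y t) → ‖y'‖ ≤ ‖y' + ζ‖ + K)
    (hcont : ∀ᵐ t ∂volume.restrict (Icc 0 T), ∀ c ∈ effDomain φ, ContinuousOn (f t c) (U t))
    (hlip : ∀ᵐ t ∂volume.restrict (Icc 0 T), ∀ w ∈ U t,
      LipschitzOnWith M (fun c => f t c w) (effDomain φ))
    (hbd : ∀ᵐ t ∂volume.restrict (Icc 0 T), ∀ c ∈ effDomain φ, ∀ w ∈ U t, ‖f t c w‖ ≤ M)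
    (hmeas : ∀ c ∈ effDomain φ, ∀ w ∈ controls T U,
      AEMeasurable (fun t => f t c (w t)) (volume.restrict (Icc 0 T)))
    (hU_graph : MeasurableSet[lebesgueSigma.prod inferInstance]
      {p : ℝ × F | p.1 ∈ Icc 0 T ∧ p.2 ∈ U p.1})
    (hU : ∀ t ∈ Icc 0 T, IsCompact (U t))
    (hconv : ∀ᵐ t ∂volume.restrict (Icc 0 T), ∀ c ∈ effDomain φ, Convex ℝ (f t c '' U t))
    (hC₀ : IsClosed C₀) (hCT : IsClosed CT)
    {xs : ℕ → ℝ → E} {us : ℕ → ℝ → F} (hadm : ∀ k, IsAdmissible T f φ C₀ CT U (xs k) (us k))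
    {a b : E} (ha : Tendsto (fun k => xs k 0) atTop (𝓝 a))
    (hb : Tendsto (fun k => xs k T) atTop (𝓝 b)) :
    ∃ x u, IsAdmissible T f φ C₀ CT U x u ∧ x 0 = a ∧ x T = b := by
  have h0T : (0 : ℝ) ∈ Icc 0 T := left_mem_Icc.2 hT.le
  have hTT : T ∈ Icc 0 T := right_mem_Icc.2 hT.le
  have hdom := hcpt.isClosed
  -- superposition with Lipschitz curves and controls
  have hsup : ∀ y : ℝ → E, ∀ L : ℝ≥0, LipschitzOnWith L y (Icc 0 T) →
      (∀ t ∈ Icc 0 T, y t ∈ effDomain φ) → ∀ w ∈ controls T U,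
      AEMeasurable (fun t => f t (y t) (w t)) (volume.restrict (Icc 0 T)) := by
    intro y L hy hyC w hw
    refine aemeasurable_caratheodory_comp (C := effDomain φ) (h := fun t c => f t c (w t)) hne
      (fun c hc => hmeas c hc w hw) ?_ (hy.continuousOn.aemeasurable measurableSet_Icc) ?_
    · filter_upwards [hlip, hw.2] with t h1 h2 using (h1 _ h2).continuousOn
    · filter_upwards [ae_restrict_mem measurableSet_Icc] with t ht using hyC t ht
  -- uniform estimates
  have hxsC : ∀ k, ∀ t ∈ Icc 0 T, xs k t ∈ effDomain φ := fun k =>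
    (hadm k).mem_effDomain hT hdom hne
  have hxsL : ∀ k, LipschitzOnWith (M + K) (xs k) (Icc 0 T) := fun k =>
    (hadm k).lipschitzOnWith hT (hxsC k) hbd hvel
  let p : ℕ → ℝ → E := fun k t => f t (xs k t) (us k t)
  have hpM : ∀ k, ∀ᵐ t ∂volume.restrict (Icc 0 T), ‖p k t‖ ≤ M := by
    intro k
    filter_upwards [hbd, (hadm k).control.2, ae_restrict_mem measurableSet_Icc] with t h1 h2 h3
    exact h1 _ (hxsC k t h3) _ h2
  have hpi : ∀ k, IntervalIntegrable (p k) volume 0 T := fun k =>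
    intervalIntegrable_of_ae_norm_le hT.le
      (hsup _ _ (hxsL k) (hxsC k) _ (hadm k).control) (hpM k)
  let Ps : ℕ → ℝ → E := fun k t => ∫ τ in (0 : ℝ)..t, p k τ
  have hPsL : ∀ k, LipschitzOnWith M (Ps k) (Icc 0 T) := fun k =>
    lipschitzOnWith_integral (hpi k) hT.le (hpM k)
  have hPsd : ∀ k, ∀ᵐ t ∂volume.restrict (Icc 0 T), HasDerivAt (Ps k) (p k t) t := by
    intro k
    have h1 := (hpi k).ae_hasDerivAt_integral
    rw [uIcc_of_le hT.le] at h1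
    filter_upwards [ae_restrict_of_ae h1, ae_restrict_mem measurableSet_Icc] with t h2 h3
    exact h2 h3 0 h0T
  have hPsB : ∀ k, ∀ t ∈ Icc 0 T, Ps k t ∈ Metric.closedBall (0 : E) (M * T) := by
    intro k t ht
    have h1 := (hPsL k).dist_le_mul t ht 0 h0T
    have h2 : Ps k 0 = 0 := intervalIntegral.integral_same
    rw [h2, Real.dist_eq, sub_zero, abs_of_nonneg ht.1] at h1
    exact Metric.mem_closedBall.2 (h1.trans (by gcongr; exact ht.2))
  -- a convergent subsequence
  obtain ⟨s, z, hs, hzL, hz⟩ := exists_subseq_tendsto_of_lipschitzOnWith hT.le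
    (hcpt.prod (isCompact_closedBall (0 : E) (M * T))) (z := fun k t => (xs k t, Ps k t))
    (fun k => (hxsL k).prodMk (hPsL k)) (fun k t ht => ⟨hxsC k t ht, hPsB k t ht⟩)
  let x : ℝ → E := fun t => (z t).1
  let P : ℝ → E := fun t => (z t).2
  have hx : ∀ t ∈ Icc 0 T, Tendsto (fun k => xs (s k) t) atTop (𝓝 (x t)) := fun t ht =>
    (continuous_fst.tendsto _).comp (hz t ht)
  have hP : ∀ t ∈ Icc 0 T, Tendsto (fun k => Ps (s k) t) atTop (𝓝 (P t)) := fun t ht =>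
    (continuous_snd.tendsto _).comp (hz t ht)
  have hxC : ∀ t ∈ Icc 0 T, x t ∈ effDomain φ := fun t ht =>
    hdom.mem_of_tendsto (hx t ht) (Eventually.of_forall fun k => hxsC _ t ht)
  have hxL : LipschitzOnWith (M + K) x (Icc 0 T) :=
    LipschitzOnWith.of_dist_le_mul fun t ht τ hτ =>
      le_of_tendsto' ((hx t ht).dist (hx τ hτ)) fun k => (hxsL (s k)).dist_le_mul t ht τ hτ
  have hPL : LipschitzOnWith M P (Icc 0 T) :=
    LipschitzOnWith.of_dist_le_mul fun t ht τ hτ =>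
      le_of_tendsto' ((hP t ht).dist (hP τ hτ)) fun k => (hPsL (s k)).dist_le_mul t ht τ hτ
  have hdiff : ∀ {y : ℝ → E} {L : ℝ≥0}, LipschitzOnWith L y (Icc 0 T) →
      ∀ᵐ t ∂volume.restrict (Icc 0 T), DifferentiableAt ℝ y t := by
    intro y L hy
    filter_upwards [hy.ae_differentiableWithinAt_real measurableSet_Icc,
      ae_restrict_Icc_mem_Ioo 0 T] with t h1 h2
    exact h1.differentiableAt (Icc_mem_nhds h2.1 h2.2)
  -- a Castaing representation of the control sets
  obtain ⟨G, hG, hGU⟩ := exists_measurableSet_ae_iff hU_graph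
  have hGU' : ∀ᵐ t ∂volume.restrict (Icc 0 T), ∀ y, (t, y) ∈ G ↔ y ∈ U t := by
    filter_upwards [ae_restrict_of_ae hGU, ae_restrict_mem measurableSet_Icc] with t h1 h2 y
    exact (h1 y).trans (and_iff_right h2)
  have hUc : ∀ᵐ t ∂volume.restrict (Icc 0 T), IsCompact (U t) := by
    filter_upwards [ae_restrict_mem measurableSet_Icc] with t ht using hU t ht
  obtain ⟨u, hum, hu⟩ := exists_castaing (volume.restrict (Icc 0 T)) hG (by
      filter_upwards [hGU', (hadm 0).control.2] with t h1 h2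
      exact ⟨us 0 t, (h1 _).2 h2⟩) (by
      filter_upwards [hGU', hUc] with t h1 h2
      simpa only [h1, ofPred_mem_eq] using h2.isClosed)
  have huU : ∀ᵐ t ∂volume.restrict (Icc 0 T), ∀ j, u j t ∈ U t := by
    filter_upwards [hGU', hu] with t h1 h2 j using (h1 _).1 (h2.1 j)
  have hud : ∀ᵐ t ∂volume.restrict (Icc 0 T), ∀ y ∈ U t, ∀ ε > 0, ∃ j, dist (u j t) y < ε := by
    filter_upwards [hGU', hu] with t h1 h2 y hy using h2.2 y ((h1 y).2 hy)
  have hhm : ∀ j, AEMeasurable (fun t => f t (x t) (u j t)) (volume.restrict (Icc 0 T)) := fun j =>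
    hsup x _ hxL hxC _ ⟨(hum j).aemeasurable, by filter_upwards [huU] with t ht using ht j⟩
  have hhc : ∀ᵐ t ∂volume.restrict (Icc 0 T), ContinuousOn (f t (x t)) (U t) := by
    filter_upwards [hcont, ae_restrict_mem measurableSet_Icc] with t h1 h2 using h1 _ (hxC t h2)
  -- the limit perturbation is a velocity of the control system
  obtain ⟨D, hD⟩ := Metric.isBounded_iff.1 hcpt.isBounded
  have hmem : ∀ᵐ t ∂volume.restrict (Icc 0 T), deriv P t ∈ f t (x t) '' U t := by
    refine ae_deriv_mem_image (M := M) hT.le M.2 huU hud hhm hhc hUc ?_ ?_ (hdiff hPL) ?_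
    · filter_upwards [hbd, ae_restrict_mem measurableSet_Icc] with t h1 h2 using h1 _ (hxC t h2)
    · filter_upwards [hconv, ae_restrict_mem measurableSet_Icc] with t h1 h2 using h1 _ (hxC t h2)
    · intro e σ hσ hσU t₁ t₂ h1 h2 h3
      exact inner_sub_le_integral_of_tendsto hT.le hlip (fun k => (hadm (s k)).control.2)
        (fun k => hxsL (s k)) hxL (fun k => hxsC (s k)) hxC
        (fun y hy w hw => by simpa [dist_eq_norm] using hD hy hw) hx (fun k => hpi (s k)) hP e
        hσ hσU h1 h2 h3
  obtain ⟨v, hvm, hv⟩ := exists_measurable_selection_eq (volume.restrict (Icc 0 T)) hG hGU'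
    (by filter_upwards [hUc] with t ht using ht.isClosed) hum huU hud hhm hhc
    (measurable_deriv P).aemeasurable hmem
  have hac : ∀ {y : ℝ → E} {L : ℝ≥0}, LipschitzOnWith L y (Icc 0 T) →
      AbsolutelyContinuousOnInterval y 0 T := fun hy =>
    LipschitzOnWith.absolutelyContinuousOnInterval (by rwa [uIcc_of_le hT.le])
  have hx0 : x 0 = a := tendsto_nhds_unique (hx 0 h0T) (ha.comp hs.tendsto_atTop)
  have hxT : x T = b := tendsto_nhds_unique (hx T hTT) (hb.comp hs.tendsto_atTop)
  refine ⟨x, v, ⟨hac hxL, ⟨hvm.aemeasurable, by filter_upwards [hv] with t ht using ht.1⟩, ?_,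
    hC₀.mem_of_tendsto (hx 0 h0T) (Eventually.of_forall fun k => (hadm _).initial),
    hCT.mem_of_tendsto (hx T hTT) (Eventually.of_forall fun k => (hadm _).terminal)⟩, hx0, hxT⟩
  filter_upwards [hv, hdiff hPL, hdiff hxL, ae_restrict_Icc_mem_Ioo 0 T] with t h1 h2 h3 h4
  have hxt := hxC t (Ioo_subset_Icc_self h4)
  obtain ⟨w, hw⟩ := hhyp (x t) hxt
  refine ⟨deriv P t - deriv x t, ?_, ?_⟩
  · refine mem_clarkeSubdifferential_of_tendsto hbot hK (xs := fun k => xs (s k))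
      (Zs := fun k => Ps (s k) - xs (s k)) (Z := P - x) (fun k => hxsL (s k)) hx
      (fun k => (hac (hPsL (s k))).sub (hac (hxsL (s k))))
      (fun τ hτ => (hP τ hτ).sub (hx τ hτ)) (fun k => ?_) h4 hxt hw
      (h2.hasDerivAt.sub h3.hasDerivAt)
    filter_upwards [(hadm (s k)).dynamics, hPsd (s k)] with τ ⟨ζ, hζ, hd⟩ hPd
    refine ⟨ζ, hζ, ?_⟩
    have := hPd.sub hd
    rwa [show p (s k) τ - (f τ (xs (s k) τ) (us (s k) τ) - ζ) = ζ from sub_sub_cancel _ _] at this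
  · rw [h1.2, sub_sub_cancel]
    exact h3.hasDerivAt

end Closure

/-- The constraint qualification in dual form: at every point of the set some direction points
strictly inside all active constraints. -/
lemma exists_fderiv_neg_of_qualification {E : Type*} [NormedAddCommGroup E] [InnerProductSpace ℝ E]
    [FiniteDimensional ℝ E] {ι : Type*} [Fintype ι] {ψ : ι → E → ℝ} {C : Set E} {η : ℝ}
    (hη : 0 < η)
    (h : ∀ c ∈ C, (∃ i, ψ i c = 0) →
      ∀ l : ι → ℝ, (∀ i, 0 ≤ l i) → ∑ i with ψ i c = 0, l i = 1 →
        2 * η < ‖∑ i with ψ i c = 0, l i • gradient (ψ i) c‖) {c : E} (hc : c ∈ C) :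
    ∃ v : E, ∀ i, ψ i c = 0 → fderiv ℝ (ψ i) c v < 0 := by
  classical
  obtain ⟨v, hv⟩ := exists_inner_neg_of_sum_ne_zero (Finset.univ.filter fun i => ψ i c = 0)
    (fun i => gradient (ψ i) c) (fun l hl hl1 h0 => by
      have hex : ∃ i, ψ i c = 0 := by
        by_contra! hno
        simp [hno] at hl1
      have := h c hc hex l hl (by convert hl1)
      rw [show ∑ i with ψ i c = 0, l i • gradient (ψ i) c = 0 by convert h0, norm_zero] at this
      linarith)
  refine ⟨v, fun i hi => ?_⟩
  have := hv i (by simpa using hi)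
  rwa [gradient, InnerProductSpace.toDual_symm_apply] at this

end Sweeping

theorem mainTheorem3 (n m r : ℕ) (T : ℝ) (hT : 0 < T)
    (g : EuclideanSpace ℝ (Fin n) × EuclideanSpace ℝ (Fin n) → EReal)
    (f : ℝ → EuclideanSpace ℝ (Fin n) → EuclideanSpace ℝ (Fin m) → EuclideanSpace ℝ (Fin n))
    (φ : EuclideanSpace ℝ (Fin n) → EReal)
    (ψ : Fin r → EuclideanSpace ℝ (Fin n) → ℝ)
    (C C₀ CT : Set (EuclideanSpace ℝ (Fin n)))
    (U : ℝ → Set (EuclideanSpace ℝ (Fin m)))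
    -- `φ` is lower semicontinuous with values in `ℝ ∪ {∞}`, and `C = dom φ`
    (hφ_bot : ∀ x, φ x ≠ ⊥)
    (hφ_lsc : LowerSemicontinuous φ)
    (hC : C = Sweeping.effDomain φ)
    -- `C` is compact, nonempty, and the intersection of the zero-sublevel sets of the `ψ i`
    (hC_compact : IsCompact C)
    (hC_nonempty : C.Nonempty)
    (hC_psi : C = ⋂ i, {x | ψ i x ≤ 0})
    -- (A1), global version
    (hA1_meas : ∀ x ∈ C, ∀ u ∈ ⋃ t ∈ Icc 0 T, U t,
      AEMeasurable (fun t => f t x u) (volume.restrict (Icc 0 T)))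
    (hA1 : ∃ M : ℝ≥0, 0 < M ∧ ∀ᵐ t ∂(volume.restrict (Icc 0 T)),
      ContinuousOn (fun p : EuclideanSpace ℝ (Fin n) × EuclideanSpace ℝ (Fin m) => f t p.1 p.2)
        (C ×ˢ U t) ∧
      (∀ u ∈ U t, LipschitzOnWith M (fun x => f t x u) C) ∧
      ∀ x ∈ C, ∀ u ∈ U t, ‖f t x u‖ ≤ M)
    -- measurability of `f` along the control functions
    (hf_meas : ∀ x ∈ C, ∀ u ∈ Sweeping.controls T U,
      AEMeasurable (fun t => f t x (u t)) (volume.restrict (Icc 0 T)))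
    -- (A2.1)
    (hA21 : ∃ ρ : ℝ, 0 < ρ ∧ ∀ i, Sweeping.IsC11On (ψ i) (Metric.thickening ρ C))
    -- (A2.2)
    (hA22 : ∃ η : ℝ, 0 < η ∧ ∀ c ∈ C, (∃ i, ψ i c = 0) →
      ∀ l : Fin r → ℝ, (∀ i, 0 ≤ l i) → ∑ i with ψ i c = 0, l i = 1 →
        2 * η < ‖∑ i with ψ i c = 0, l i • gradient (ψ i) c‖)
    -- (A2.5)
    (hA25 : IsConnected (interior C))
    -- (A3)
    (hA3_lip : ∃ K : ℝ≥0, LipschitzOnWith K (fun x => (φ x).toReal) C)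
    (hA3_C1 : ContDiffOn ℝ 1 (fun x => (φ x).toReal) (interior C))
    (hA3_grad : ∃ K : ℝ≥0, LipschitzOnWith K (gradient fun x => (φ x).toReal) (interior C))
    -- (A4.1), (A4.2)
    (hC₀ : C₀ ⊆ C ∧ C₀.Nonempty ∧ IsClosed C₀)
    (hCT : CT.Nonempty ∧ IsClosed CT)
    -- (A4.3)
    (hU_graph : MeasurableSet[Sweeping.lebesgueSigma.prod inferInstance]
      {p : ℝ × EuclideanSpace ℝ (Fin m) | p.1 ∈ Icc 0 T ∧ p.2 ∈ U p.1})
    (hU_closed : ∀ t ∈ Icc 0 T, IsClosed (U t))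
    (hU_bdd : ∃ R : ℝ, ∀ t ∈ Icc 0 T, ∀ u ∈ U t, ‖u‖ ≤ R)
    -- `g` is lower semicontinuous with values in `ℝ ∪ {∞}`
    (hg_bot : ∀ p, g p ≠ ⊥)
    (hg_lsc : LowerSemicontinuous g)
    -- convexity of the velocity sets
    (hconv : ∀ᵐ t ∂(volume.restrict (Icc 0 T)), ∀ x ∈ C, Convex ℝ (f t x '' U t)) :
    (∃ x u, Sweeping.IsOptimal T g f φ C₀ CT U x u) ↔
      ∃ z w, Sweeping.IsAdmissible T f φ C₀ CT U z w ∧ (z 0, z T) ∈ Sweeping.effDomain g := by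
  refine ⟨fun ⟨x, u, h⟩ => ⟨x, u, h.admissible, h.finite_cost⟩, fun ⟨z, w, hzw, hfin⟩ => ?_⟩
  subst hC
  obtain ⟨M, -, hA1⟩ := hA1
  obtain ⟨ρ, hρ, hψ⟩ := hA21
  obtain ⟨η, hη, hqual⟩ := hA22
  obtain ⟨K, hK⟩ := hA3_lip
  have hstrict : ∀ c ∈ Sweeping.effDomain φ, ∀ i,
      HasStrictFDerivAt (ψ i) (fderiv ℝ (ψ i) c) c := fun c hc i =>
    ((hψ i).1.contDiffAt (Metric.isOpen_thickening.mem_nhds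
      (Metric.self_subset_thickening hρ _ hc))).hasStrictFDerivAt one_ne_zero
  have hin := fun c hc => Sweeping.exists_fderiv_neg_of_qualification hη hqual (c := c) hc
  have hhyp : ∀ c ∈ Sweeping.effDomain φ,
      ∃ v, v ∈ Sweeping.hypertangentCone (Sweeping.effDomain φ) c := by
    intro c hc
    obtain ⟨v, hv⟩ := hin c hc
    refine ⟨v, ?_⟩
    have := Sweeping.mem_hypertangentCone_of_fderiv_neg (hC_psi ▸ hc) (hstrict c hc) hv
    rwa [← hC_psi] at this
  have hUc : ∀ t ∈ Icc 0 T, IsCompact (U t) := by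
    obtain ⟨R, hR⟩ := hU_bdd
    exact fun t ht => Metric.isCompact_of_isClosed_isBounded (hU_closed t ht)
      (isBounded_iff_forall_norm_le.2 ⟨R, hR t ht⟩)
  -- the set of end points of admissible trajectories
  let S : Set (EuclideanSpace ℝ (Fin n) × EuclideanSpace ℝ (Fin n)) :=
    {q | ∃ x u, Sweeping.IsAdmissible T f φ C₀ CT U x u ∧ x 0 = q.1 ∧ x T = q.2}
  have hSsub : S ⊆ Sweeping.effDomain φ ×ˢ Sweeping.effDomain φ := by
    rintro ⟨a, b⟩ ⟨x, u, hxu, rfl, rfl⟩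
    have hx := hxu.mem_effDomain hT hC_compact.isClosed hC_nonempty
    exact ⟨hx 0 (left_mem_Icc.2 hT.le), hx T (right_mem_Icc.2 hT.le)⟩
  have hSclosed : IsClosed S := by
    refine IsSeqClosed.isClosed fun q q₀ hq hlim => ?_
    choose xs us hadm h0 h1 using hq
    refine Sweeping.exists_isAdmissible_of_tendsto hT hφ_bot hK hC_compact hC_nonempty hhyp ?_
      (hA1.mono fun t ht c hc => ?_) (hA1.mono fun t ht => ht.2.1) (hA1.mono fun t ht => ht.2.2)
      hf_meas hU_graph hUc hconv hC₀.2.2 hCT.2 hadm ?_ ?_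
    · intro y y' ζ t hy hd hζ
      obtain ⟨v, hv⟩ := hin (y t) hζ.1
      exact Sweeping.norm_deriv_le_of_mem_clarkeSubdifferential hφ_bot hK hC_psi
        (hstrict _ hζ.1) hv hy hd hζ
    · exact ht.1.comp (by fun_prop : ContinuousOn (fun u => (c, u)) (U t)) fun u hu => ⟨hc, hu⟩
    · simpa only [h0, Function.comp_def] using (continuous_fst.tendsto q₀).comp hlim
    · simpa only [h1, Function.comp_def] using (continuous_snd.tendsto q₀).comp hlim
  have hScompact : IsCompact S := (hC_compact.prod hC_compact).of_isClosed_subset hSclosed hSsub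
  obtain ⟨q, ⟨x, u, hxu, hx0, hxT⟩, hmin⟩ := LowerSemicontinuousOn.exists_isMinOn (s := S)
    ⟨(z 0, z T), z, w, hzw, rfl, rfl⟩ hScompact (hg_lsc.lowerSemicontinuousOn S)
  have hq : (x 0, x T) = q := Prod.ext hx0 hxT
  refine ⟨x, u, hxu, ?_, fun y v hyv => ?_⟩
  · rw [hq]
    exact lt_of_le_of_lt (isMinOn_iff.1 hmin _ ⟨z, w, hzw, rfl, rfl⟩) hfin
  · rw [hq]
    exact isMinOn_iff.1 hmin _ ⟨y, v, hyv, rfl, rfl⟩
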